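/- Conventions. Manifolds are topological, Hausdorff and second countable, not necessarily connected. For $n\in\mathbb N$ let $\Delta^n$ be the standard $n$-simplex and $\square^n=[0,1]^n$. For a space $X$, let $C_*(X;\mathbb R)$ be the singular chain complex with the $\ell^1$-norm with respect to the basis of singular simplices. Let $Q_n(X;\mathbb R)$ be the free $\mathbb R$-module on the continuous maps $c\colon\square^n\to X$, with the $\ell^1$-norm and the boundary $\partial c=\sum_{j=1}^n(-1)^j\,(c|_{x_j=0}-c|_{x_j=1})$, let $D_n(X;\mathbb R)$ be generated by the degenerate cubes (those independent of one of the coordinates), and let $C^\square_*(X;\mathbb R)=Q_*(X;\mathbb R)/D_*(X;\mathbb R)$ with the quotient norm. Let $F$ denote $C_*$ or $C_*^\square$. For $A\subset X$ put $F(X,A)=F(X)/F(A)$ with the quotient semi-norm, and put $F^{\mathrm{lf}}(X)=\varprojlim_K F(X,X\setminus K)$, where $K$ runs through the compact subsets of $X$. The semi-norm of $(c_K)_K\in F^{\mathrm{lf}}_n(X)$ is the infimum (in $[0,\infty]$) of $\lim_K\|\bar c_K\|$ over all Cauchy families $(\bar c_K)_K$ in $F_n(X)$ such that $\bar c_K$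 represents $c_K$ for all $K$ (for $F=C_*$ this is the $\ell^1$-norm on locally finite singular chains). The semi-norm of a homology class is the infimum of the semi-norms of the cycles representing it. The canonical natural isomorphism from singular homology to cubical singular homology (also in the relative and the locally finite case) is induced by the chain map $\sigma\mapsto\sigma\circ\kappa_n$, where $\kappa_n\colon\square^n\to\Delta^n$, $(x_1,\dots,x_n)\mapsto(1-x_1,\;x_1(1-x_2),\;\dots,\;x_1\cdots x_{n-1}(1-x_n),\;x_1\cdots x_n)$. For an oriented compact $n$-manifold $M$ with (possibly empty) boundary $\partial M$, let $[M,\partial M]\in H_n(M,\partial M;\mathbb R)$ be the fundamental class, i.e., the class that restricts to the given local orientation in $H_n(M,M\setminus\{x\};\mathbb R)$ for all interior points $x$. Let $\|M,\partial M\|$ be its semi-norm, and let $\|M,\partial M\|^\square$ be the semi-norm of the corresponding class in $H_n^\square(M,\partial M;\mathbb R)$. For an oriented $n$-manifold $M$ without boundary, define $\|M\|^{\mathrm{lf}},\ \|M\|^{\square,\mathrm{lf}}\in[0,\infty]$ in the same way through the locally finite fundamental class in $H_n^{\mathrm{lf}}(M;\mathbb R)$. Statement. Let $n\in\mathbb N$.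 (1) For all oriented compact $n$-manifolds $M$, $$\frac1{2^n\cdot n!}\cdot\|M,\partial M\|\;\le\;\|M,\partial M\|^\square\;\le\;\|M,\partial M\|.$$ (2) For all oriented $n$-manifolds $M$ without boundary, $$\frac1{2^n\cdot n!}\cdot\|M\|^{\mathrm{lf}}\;\le\;\|M\|^{\square,\mathrm{lf}}\;\le\;\|M\|^{\mathrm{lf}}.$$ -/

import Mathlib

open CategoryTheory Filter Topology
open scoped ENNReal

universe u

noncomputable section

namespace CubicalVolume

/-! ### A vanishing lemma for alternating sums of face maps -/

theorem alternating_sum_comp_eq_zero {m : ℕ} {A B C : Type*} [AddCommGroup A] [AddCommGroup B]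
    [AddCommGroup C] (f : Fin (m + 2) → A →+ B) (g : Fin (m + 1) → B →+ C)
    (h : ∀ i j : Fin (m + 1), i ≤ j → ∀ a, g i (f j.succ a) = g j (f i.castSucc a)) (a : A) :
    (∑ i : Fin (m + 1), (-1 : ℤ) ^ (i : ℕ) • g i) ((∑ j : Fin (m + 2), (-1 : ℤ) ^ (j : ℕ) • f j) a)
      = 0 := by
  simp only [AddMonoidHom.finsetSum_apply, map_sum, AddMonoidHom.smul_apply, map_zsmul,
    Finset.smul_sum]
  rw [Finset.sum_comm, ← Finset.sum_product']
  let P := Fin (m + 1) × Fin (m + 2)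
  let S : Finset P := {ij : P | (ij.2 : ℕ) ≤ (ij.1 : ℕ)}
  rw [Finset.univ_product_univ, ← Finset.sum_add_sum_compl S, ← eq_neg_iff_add_eq_zero,
    ← Finset.sum_neg_distrib]
  let φ : ∀ ij : P, ij ∈ S → P := fun ij hij =>
    (Fin.castLT ij.2 (lt_of_le_of_lt (Finset.mem_filter.mp hij).right (Fin.is_lt ij.1)), ij.1.succ)
  apply Finset.sum_bij φ
  · intro ij hij
    simp_rw [S, φ, Finset.compl_filter, Finset.mem_filter_univ, Fin.val_succ,
      Fin.val_castLT] at hij ⊢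
    lia
  · rintro ⟨i, j⟩ hij ⟨i', j'⟩ hij' h
    rw [Prod.mk_inj]
    exact ⟨by simpa [φ] using! congr_arg Prod.snd h,
      by simpa [φ, Fin.castSucc_castLT] using! congr_arg Fin.castSucc (congr_arg Prod.fst h)⟩
  · rintro ⟨i', j'⟩ hij'
    simp_rw [S, Finset.compl_filter, Finset.mem_filter_univ, not_le] at hij'
    refine ⟨(j'.pred <| ?_, Fin.castSucc i'), ?_, ?_⟩
    · rintro rfl
      simp at hij'
    · simp only [S, Finset.mem_filter_univ, Fin.val_castSucc, Fin.val_pred]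
      lia
    · simp [φ]
  · rintro ⟨i, j⟩ hij
    simp only [S, Finset.mem_filter_univ] at hij
    have hj : (j : ℕ) < m + 1 := lt_of_le_of_lt hij i.2
    have := h (j.castLT hj) i (by simpa [Fin.le_def] using hij) a
    simp only [φ, Fin.val_castLT, Fin.val_succ, Fin.castSucc_castLT] at this ⊢
    rw [this, smul_smul, smul_smul, ← neg_smul]
    congr 1
    ring

/-! ### Singular chains -/

/-- The standard `n`-simplex. -/
abbrev Simplex (n : ℕ) : Type := stdSimplex ℝ (Fin (n + 1))

/-- The inclusion of the `i`-th face of the standard `(n + 1)`-simplex. -/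
def simplexFace {n : ℕ} (i : Fin (n + 2)) : C(Simplex n, Simplex (n + 1)) :=
  ⟨stdSimplex.map i.succAbove, stdSimplex.continuous_map _⟩

theorem simplexFace_comp {n : ℕ} (i j : Fin (n + 2)) (h : i ≤ j) :
    (simplexFace j.succ).comp (simplexFace i) =
      (simplexFace i.castSucc).comp (simplexFace j) := by
  ext1 x
  simp only [simplexFace, ContinuousMap.comp_apply, ContinuousMap.coe_mk,
    stdSimplex.map_comp_apply]
  congr 1
  funext k
  simp only [Function.comp, Fin.succAbove, Fin.ext_iff, Fin.lt_def, Fin.le_def] at *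
  grind

/-- The singular `n`-chains of `X` with coefficients in `R`. -/
abbrev SingChain (R : Type) [Ring R] (n : ℕ) (X : Type u) [TopologicalSpace X] : Type u :=
  C(Simplex n, X) →₀ R

/-- The singular boundary, `∂σ = ∑ i, (-1)^i • (σ ∘ i-th face)`. -/
def singBoundary (R : Type) [Ring R] (n : ℕ) (X : Type u) [TopologicalSpace X] :
    SingChain R (n + 1) X →+ SingChain R n X :=
  ∑ i : Fin (n + 2), (-1 : ℤ) ^ (i : ℕ) •
    Finsupp.mapDomain.addMonoidHom (fun σ : C(Simplex (n + 1), X) => σ.comp (simplexFace i))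

theorem singBoundary_singBoundary (R : Type) [Ring R] (n : ℕ) (X : Type u) [TopologicalSpace X]
    (c : SingChain R (n + 2) X) : singBoundary R n X (singBoundary R (n + 1) X c) = 0 := by
  refine alternating_sum_comp_eq_zero _ _ (fun i j hij c => ?_) c
  simp only [Finsupp.mapDomain.addMonoidHom_apply, ← Finsupp.mapDomain_comp]
  congr 1
  funext σ
  simp only [Function.comp, ContinuousMap.comp_assoc, simplexFace_comp i j hij]

/-- The singular chain complex of `X` with coefficients in `R`. -/
def singComplex (R : Type) [Ring R] (X : TopCat.{u}) : ChainComplex AddCommGrpCat.{u} ℕ :=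
  ChainComplex.of (fun n => AddCommGrpCat.of (SingChain R n X))
    (fun n => AddCommGrpCat.ofHom (singBoundary R n X))
    (fun n => AddCommGrpCat.hom_ext (AddMonoidHom.ext (singBoundary_singBoundary R n X)))

/-- The map on singular chains induced by a continuous map. -/
def singMap (R : Type) [Ring R] (n : ℕ) {X Y : Type u} [TopologicalSpace X] [TopologicalSpace Y]
    (f : C(X, Y)) : SingChain R n X →+ SingChain R n Y :=
  Finsupp.mapDomain.addMonoidHom (fun σ => f.comp σ)

/-- The singular chain complex with coefficients in `R`, as a functor on topological spaces. -/
def singular (R : Type) [Ring R] : TopCat.{u} ⥤ ChainComplex AddCommGrpCat.{u} ℕ where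
  obj X := singComplex R X
  map {X Y} f := ChainComplex.ofHom (X := singComplex R X) (Y := singComplex R Y)
    (fun n => AddCommGrpCat.ofHom (singMap R n f.hom))
    (fun n => by
      simp only [singComplex, ChainComplex.of_d]
      refine AddCommGrpCat.hom_ext (AddMonoidHom.ext fun c => ?_)
      change singBoundary R n Y (singMap R (n + 1) f.hom c) =
        singMap R n f.hom (singBoundary R n X c)
      simp only [singBoundary, singMap, AddMonoidHom.finsetSum_apply, AddMonoidHom.smul_apply,
        map_sum, map_zsmul, Finsupp.mapDomain.addMonoidHom_apply, ← Finsupp.mapDomain_comp]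
      rfl)
  map_id X := by
    ext n : 1
    refine AddCommGrpCat.hom_ext (AddMonoidHom.ext fun c => ?_)
    exact Finsupp.mapDomain_id
  map_comp f g := by
    ext n : 1
    refine AddCommGrpCat.hom_ext (AddMonoidHom.ext fun c => ?_)
    exact Finsupp.mapDomain_comp (f := fun σ => f.hom.comp σ) (g := fun σ => g.hom.comp σ)

/-- The `ℓ¹`-norm with respect to the basis of singular simplices. -/
def singNorm (X : TopCat.{u}) (n : ℕ) (c : ((singular ℝ).obj X).X n) : ℝ≥0∞ :=
  Finsupp.sum (show SingChain ℝ n X from c) fun _ a => ‖a‖ₑ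

/-- The change of coefficients from `ℤ` to `ℝ`. -/
def intToReal : singular.{u} ℤ ⟶ singular.{u} ℝ where
  app X := ChainComplex.ofHom (X := singComplex ℤ X) (Y := singComplex ℝ X)
    (fun n => AddCommGrpCat.ofHom (Finsupp.mapRange.addMonoidHom (Int.castAddHom ℝ)))
    (fun n => by
      simp only [singComplex, ChainComplex.of_d]
      refine AddCommGrpCat.hom_ext (AddMonoidHom.ext fun c => ?_)
      change singBoundary ℝ n X (Finsupp.mapRange.addMonoidHom (Int.castAddHom ℝ) c) =
        Finsupp.mapRange.addMonoidHom (Int.castAddHom ℝ) (singBoundary ℤ n X c)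
      simp only [singBoundary, AddMonoidHom.finsetSum_apply, AddMonoidHom.smul_apply,
        map_sum, map_zsmul, Finsupp.mapDomain.addMonoidHom_apply,
        Finsupp.mapRange.addMonoidHom_apply]
      refine Finset.sum_congr rfl fun i _ => ?_
      congr 1
      exact Finsupp.mapDomain_mapRange _ _ _ (map_zero _) (map_add _))
  naturality X Y f := by
    ext n : 1
    refine AddCommGrpCat.hom_ext (AddMonoidHom.ext fun c => ?_)
    exact (Finsupp.mapDomain_mapRange (fun σ => f.hom.comp σ) c (Int.castAddHom ℝ)
      (map_zero _) (map_add _)).symm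

/-! ### Cubical singular chains -/

/-- The standard `n`-cube `[0,1]^n`. -/
abbrev Cube (n : ℕ) : Type := Fin n → unitInterval

/-- The inclusion of the face of the `(n + 1)`-cube on which the `j`-th coordinate is `e`
(used for `e = 0` and `e = 1`). -/
def cubeFace {n : ℕ} (j : Fin (n + 1)) (e : unitInterval) : C(Cube n, Cube (n + 1)) :=
  ⟨fun x => Fin.insertNth (α := fun _ => unitInterval) j e x, by fun_prop⟩

theorem cubeFace_same {n : ℕ} (j : Fin (n + 1)) (e : unitInterval) (x : Cube n) :
    cubeFace j e x j = e := Fin.insertNth_apply_same (α := fun _ => unitInterval) j e x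

theorem cubeFace_succAbove {n : ℕ} (j : Fin (n + 1)) (e : unitInterval) (x : Cube n) (k : Fin n) :
    cubeFace j e x (j.succAbove k) = x k :=
  Fin.insertNth_apply_succAbove (α := fun _ => unitInterval) j e x k

theorem cubeFace_comp {n : ℕ} (i j : Fin (n + 1)) (h : i ≤ j) (a b : unitInterval) :
    (cubeFace j.succ b).comp (cubeFace i a) = (cubeFace i.castSucc a).comp (cubeFace j b) := by
  have h1 : j.succ.succAbove i = i.castSucc := by
    simp only [Fin.succAbove, Fin.ext_iff, Fin.lt_def, Fin.le_def] at *
    grind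
  have h2 : i.castSucc.succAbove j = j.succ := by
    simp only [Fin.succAbove, Fin.ext_iff, Fin.lt_def, Fin.le_def] at *
    grind
  have h3 : ∀ k : Fin n, i.castSucc.succAbove (j.succAbove k) =
      j.succ.succAbove (i.succAbove k) := by
    intro k
    simp only [Fin.succAbove, Fin.ext_iff, Fin.lt_def, Fin.le_def] at *
    grind
  ext1 x
  simp only [ContinuousMap.comp_apply]
  funext k
  obtain rfl | ⟨k, rfl⟩ := Fin.eq_self_or_eq_succAbove i.castSucc k
  · rw [cubeFace_same, ← h1, cubeFace_succAbove, cubeFace_same]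
  · rw [cubeFace_succAbove]
    obtain rfl | ⟨k, rfl⟩ := Fin.eq_self_or_eq_succAbove j k
    · rw [h2, cubeFace_same, cubeFace_same]
    · rw [h3, cubeFace_succAbove, cubeFace_succAbove, cubeFace_succAbove]

/-- A singular cube is degenerate if it is independent of one of the coordinates. -/
def IsDegenerate {n : ℕ} {X : Type u} [TopologicalSpace X] (c : C(Cube n, X)) : Prop :=
  ∃ j : Fin n, ∀ (x : Cube n) (t : unitInterval), c (Function.update x j t) = c x

/-- The free module `Q_n(X; ℝ)` on all singular `n`-cubes of `X`. -/
abbrev CubeChain (n : ℕ) (X : Type u) [TopologicalSpace X] : Type u :=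
  C(Cube n, X) →₀ ℝ

/-- The difference `c ↦ c ∘ (j,1)-face - c ∘ (j,0)-face` of opposite faces. -/
def oppositeFaces (n : ℕ) (X : Type u) [TopologicalSpace X] (j : Fin (n + 1)) :
    CubeChain (n + 1) X →+ CubeChain n X :=
  Finsupp.mapDomain.addMonoidHom (fun c : C(Cube (n + 1), X) => c.comp (cubeFace j 1)) -
    Finsupp.mapDomain.addMonoidHom (fun c : C(Cube (n + 1), X) => c.comp (cubeFace j 0))

/-- The cubical boundary. The coordinates are numbered from `0` here, whence the sign:
`∂c = ∑ j, (-1)^(j+1) • (c ∘ (j,0)-face - c ∘ (j,1)-face)`. -/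
def cubeBoundary (n : ℕ) (X : Type u) [TopologicalSpace X] :
    CubeChain (n + 1) X →+ CubeChain n X :=
  ∑ j : Fin (n + 1), (-1 : ℤ) ^ (j : ℕ) • oppositeFaces n X j

theorem cubeBoundary_cubeBoundary (n : ℕ) (X : Type u) [TopologicalSpace X]
    (c : CubeChain (n + 2) X) : cubeBoundary n X (cubeBoundary (n + 1) X c) = 0 := by
  refine alternating_sum_comp_eq_zero _ _ (fun i j hij c => ?_) c
  have key : ∀ a b : unitInterval,
      (fun c : C(Cube (n + 1), X) => c.comp (cubeFace i a)) ∘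
        (fun c : C(Cube (n + 2), X) => c.comp (cubeFace j.succ b)) =
      (fun c : C(Cube (n + 1), X) => c.comp (cubeFace j b)) ∘
        (fun c : C(Cube (n + 2), X) => c.comp (cubeFace i.castSucc a)) := by
    intro a b
    funext σ
    simp only [Function.comp, ContinuousMap.comp_assoc, cubeFace_comp i j hij]
  simp only [oppositeFaces, AddMonoidHom.sub_apply, map_sub,
    Finsupp.mapDomain.addMonoidHom_apply, ← Finsupp.mapDomain_comp, key]
  abel

/-- The subgroup `D_n(X; ℝ)` of `Q_n(X; ℝ)` generated by the multiples of degenerate cubes. -/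
def degenerateChains (n : ℕ) (X : Type u) [TopologicalSpace X] : AddSubgroup (CubeChain n X) :=
  AddSubgroup.closure {q | ∃ (c : C(Cube n, X)) (a : ℝ), IsDegenerate c ∧ q = Finsupp.single c a}

theorem single_mem_degenerateChains {n : ℕ} {X : Type u} [TopologicalSpace X] {c : C(Cube n, X)}
    (h : IsDegenerate c) (a : ℝ) : Finsupp.single c a ∈ degenerateChains n X :=
  AddSubgroup.subset_closure ⟨c, a, h, rfl⟩

theorem degenerateChains_le_comap_boundary (n : ℕ) (X : Type u) [TopologicalSpace X] :
    degenerateChains (n + 1) X ≤ (degenerateChains n X).comap (cubeBoundary n X) := by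
  refine (AddSubgroup.closure_le _).2 ?_
  rintro _ ⟨c, a, ⟨j, hj⟩, rfl⟩
  change cubeBoundary n X _ ∈ degenerateChains n X
  simp only [cubeBoundary, AddMonoidHom.finsetSum_apply, AddMonoidHom.smul_apply]
  refine AddSubgroup.sum_mem _ fun k _ => AddSubgroup.zsmul_mem _ ?_ _
  simp only [oppositeFaces, AddMonoidHom.sub_apply, Finsupp.mapDomain.addMonoidHom_apply,
    Finsupp.mapDomain_single]
  obtain rfl | ⟨i, rfl⟩ := Fin.eq_self_or_eq_succAbove k j
  · have : c.comp (cubeFace j 1) = c.comp (cubeFace j 0) := by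
      ext1 x
      simp only [ContinuousMap.comp_apply]
      rw [← hj (cubeFace j 1 x) 0]
      congr 1
      funext l
      obtain rfl | ⟨l, rfl⟩ := Fin.eq_self_or_eq_succAbove j l
      · simp [cubeFace_same]
      · rw [Function.update_of_ne (Fin.succAbove_ne _ _), cubeFace_succAbove, cubeFace_succAbove]
    rw [this, sub_self]
    exact AddSubgroup.zero_mem _
  · have : ∀ e, IsDegenerate (c.comp (cubeFace k e)) := by
      refine fun e => ⟨i, fun x t => ?_⟩
      simp only [ContinuousMap.comp_apply]
      rw [← hj (cubeFace k e x) t]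
      congr 1
      funext l
      obtain rfl | ⟨l, rfl⟩ := Fin.eq_self_or_eq_succAbove k l
      · rw [Function.update_of_ne (Fin.succAbove_ne _ _).symm, cubeFace_same, cubeFace_same]
      · rw [cubeFace_succAbove]
        by_cases h : l = i
        · subst h; simp
        · rw [Function.update_of_ne h, Function.update_of_ne (by simpa using h),
            cubeFace_succAbove]
    exact AddSubgroup.sub_mem _ (single_mem_degenerateChains (this 1) a)
      (single_mem_degenerateChains (this 0) a)

/-- The cubical chain module `C_n^□(X; ℝ) = Q_n(X; ℝ) / D_n(X; ℝ)`. -/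
abbrev CubicalChain (n : ℕ) (X : Type u) [TopologicalSpace X] : Type u :=
  CubeChain n X ⧸ degenerateChains n X

/-- The boundary on `C_*^□(X; ℝ)`. -/
def cubicalBoundary (n : ℕ) (X : Type u) [TopologicalSpace X] :
    CubicalChain (n + 1) X →+ CubicalChain n X :=
  QuotientAddGroup.map _ _ (cubeBoundary n X) (degenerateChains_le_comap_boundary n X)

/-- The cubical chain complex of `X`. -/
def cubicalComplex (X : TopCat.{u}) : ChainComplex AddCommGrpCat.{u} ℕ :=
  ChainComplex.of (fun n => AddCommGrpCat.of (CubicalChain n X))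
    (fun n => AddCommGrpCat.ofHom (cubicalBoundary n X))
    (fun n => by
      refine AddCommGrpCat.hom_ext (AddMonoidHom.ext fun c => ?_)
      obtain ⟨c, rfl⟩ := QuotientAddGroup.mk_surjective c
      exact congrArg QuotientAddGroup.mk (cubeBoundary_cubeBoundary n X c))

/-- The map on `Q_n` induced by a continuous map. -/
def cubeMap (n : ℕ) {X Y : Type u} [TopologicalSpace X] [TopologicalSpace Y]
    (f : C(X, Y)) : CubeChain n X →+ CubeChain n Y :=
  Finsupp.mapDomain.addMonoidHom (fun c => f.comp c)

theorem degenerateChains_le_comap_map (n : ℕ) {X Y : Type u} [TopologicalSpace X]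
    [TopologicalSpace Y] (f : C(X, Y)) :
    degenerateChains n X ≤ (degenerateChains n Y).comap (cubeMap n f) := by
  refine (AddSubgroup.closure_le _).2 ?_
  rintro _ ⟨c, a, ⟨j, hj⟩, rfl⟩
  change cubeMap n f _ ∈ degenerateChains n Y
  simp only [cubeMap, Finsupp.mapDomain.addMonoidHom_apply, Finsupp.mapDomain_single]
  exact single_mem_degenerateChains ⟨j, fun x t => congrArg f (hj x t)⟩ a

/-- The map on cubical chains induced by a continuous map. -/
def cubicalMap (n : ℕ) {X Y : Type u} [TopologicalSpace X] [TopologicalSpace Y]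
    (f : C(X, Y)) : CubicalChain n X →+ CubicalChain n Y :=
  QuotientAddGroup.map _ _ (cubeMap n f) (degenerateChains_le_comap_map n f)

/-- The cubical chain complex `C_*^□(·; ℝ)` as a functor on topological spaces. -/
def cubical : TopCat.{u} ⥤ ChainComplex AddCommGrpCat.{u} ℕ where
  obj X := cubicalComplex X
  map {X Y} f := ChainComplex.ofHom (X := cubicalComplex X) (Y := cubicalComplex Y)
    (fun n => AddCommGrpCat.ofHom (cubicalMap n f.hom))
    (fun n => by
      simp only [cubicalComplex, ChainComplex.of_d]
      refine AddCommGrpCat.hom_ext (AddMonoidHom.ext fun c => ?_)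
      obtain ⟨c, rfl⟩ := QuotientAddGroup.mk_surjective c
      refine congrArg QuotientAddGroup.mk (?_ : cubeBoundary n Y (cubeMap (n + 1) f.hom c) =
        cubeMap n f.hom (cubeBoundary n X c))
      simp only [cubeBoundary, cubeMap, oppositeFaces, AddMonoidHom.finsetSum_apply,
        AddMonoidHom.smul_apply, AddMonoidHom.sub_apply, map_sum, map_sub, map_zsmul,
        Finsupp.mapDomain.addMonoidHom_apply, ← Finsupp.mapDomain_comp]
      rfl)
  map_id X := by
    ext n : 1
    refine AddCommGrpCat.hom_ext (AddMonoidHom.ext fun c => ?_)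
    obtain ⟨c, rfl⟩ := QuotientAddGroup.mk_surjective c
    exact congrArg QuotientAddGroup.mk Finsupp.mapDomain_id
  map_comp f g := by
    ext n : 1
    refine AddCommGrpCat.hom_ext (AddMonoidHom.ext fun c => ?_)
    obtain ⟨c, rfl⟩ := QuotientAddGroup.mk_surjective c
    exact congrArg QuotientAddGroup.mk
      (Finsupp.mapDomain_comp (f := fun σ => f.hom.comp σ) (g := fun σ => g.hom.comp σ))

/-- The norm on `C_n^□(X; ℝ)` induced from the `ℓ¹`-norm on `Q_n(X; ℝ)`. -/
def cubicalNorm (X : TopCat.{u}) (n : ℕ) (c : (cubical.obj X).X n) : ℝ≥0∞ :=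
  ⨅ (q : CubeChain n X) (_ : (QuotientAddGroup.mk q : CubicalChain n X) = c),
    q.sum fun _ a => ‖a‖ₑ

/-! ### The comparison of singular and cubical homology -/

/-- The product `x_0 ⋯ x_(m-1)` of the first `m` coordinates if `m ≤ n`, and `0` if `n < m`. -/
def initialProd {n : ℕ} (x : Cube n) (m : ℕ) : ℝ :=
  if m ≤ n then ∏ k : Fin n, (if (k : ℕ) < m then (x k : ℝ) else 1) else 0

theorem initialProd_nonneg {n : ℕ} (x : Cube n) (m : ℕ) : 0 ≤ initialProd x m := by
  unfold initialProd
  split_ifs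
  · refine Finset.prod_nonneg fun k _ => ?_
    split_ifs
    · exact (x k).2.1
    · exact zero_le_one
  · exact le_rfl

theorem initialProd_succ_le {n : ℕ} (x : Cube n) (m : ℕ) :
    initialProd x (m + 1) ≤ initialProd x m := by
  by_cases h : m + 1 ≤ n
  · rw [initialProd, initialProd, if_pos h, if_pos (by lia)]
    refine Finset.prod_le_prod (fun k _ => ?_) fun k _ => ?_
    · split_ifs
      · exact (x k).2.1
      · exact zero_le_one
    · by_cases h1 : (k : ℕ) < m
      · rw [if_pos h1, if_pos (by lia)]
      · rw [if_neg h1]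
        split_ifs
        · exact (x k).2.2
        · exact le_rfl
  · rw [initialProd, if_neg h]
    exact initialProd_nonneg x m

theorem continuous_initialProd {n : ℕ} (m : ℕ) :
    Continuous fun x : Cube n => initialProd x m := by
  unfold initialProd
  split_ifs
  · refine continuous_finsetProd _ fun k _ => ?_
    split_ifs <;> fun_prop
  · exact continuous_const

theorem initialProd_cubeFace {n : ℕ} (j : Fin (n + 1)) (e : unitInterval) (x : Cube n) (m : ℕ)
    (hm : m ≤ n + 1) : initialProd (cubeFace j e x) m =
      if (j : ℕ) < m then e * initialProd x (m - 1) else initialProd x m := by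
  rw [initialProd, if_pos hm, Fin.prod_univ_succAbove _ j, cubeFace_same]
  simp only [cubeFace_succAbove]
  by_cases h : (j : ℕ) < m
  · rw [if_pos h, if_pos h, initialProd, if_pos (by lia)]
    congr 1
    refine Finset.prod_congr rfl fun k _ => ?_
    have : ((j.succAbove k : Fin (n + 1)) : ℕ) < m ↔ (k : ℕ) < m - 1 := by
      simp only [Fin.succAbove, Fin.lt_def]
      grind
    simp only [this]
  · rw [if_neg h, if_neg h, initialProd, if_pos (by lia), one_mul]
    refine Finset.prod_congr rfl fun k _ => ?_
    have : ((j.succAbove k : Fin (n + 1)) : ℕ) < m ↔ (k : ℕ) < m := by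
      simp only [Fin.succAbove, Fin.lt_def]
      grind
    simp only [this]

/-- The collapse of the `n`-cube onto the `n`-simplex,
`(x_0, …, x_(n-1)) ↦ (1 - x_0, x_0 (1 - x_1), …, x_0 ⋯ x_(n-2) (1 - x_(n-1)), x_0 ⋯ x_(n-1))`. -/
def collapse (n : ℕ) : C(Cube n, Simplex n) where
  toFun x := ⟨fun i => initialProd x i - initialProd x (i + 1),
    fun i => sub_nonneg.2 (initialProd_succ_le x i), by
      rw [Fin.sum_univ_eq_sum_range (fun i => initialProd x i - initialProd x (i + 1)) (n + 1),
        Finset.sum_range_sub']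
      simp [initialProd]⟩
  continuous_toFun := by
    refine Continuous.subtype_mk (continuous_pi fun i => ?_) _
    exact (continuous_initialProd _).sub (continuous_initialProd _)

theorem collapse_apply (n : ℕ) (x : Cube n) (i : Fin (n + 1)) :
    collapse n x i = initialProd x i - initialProd x (i + 1) := rfl

theorem simplexFace_same {n : ℕ} (i : Fin (n + 2)) (t : Simplex n) : simplexFace i t i = 0 := by
  change stdSimplex.map i.succAbove t i = 0
  rw [stdSimplex.map_coe, FunOnFinite.linearMap_apply_apply]
  refine Finset.sum_eq_zero fun k hk => ?_
  simp [Fin.succAbove_ne] at hk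

theorem simplexFace_succAbove {n : ℕ} (i : Fin (n + 2)) (t : Simplex n) (k : Fin (n + 1)) :
    simplexFace i t (i.succAbove k) = t k := by
  change stdSimplex.map i.succAbove t (i.succAbove k) = t k
  rw [stdSimplex.map_coe, FunOnFinite.linearMap_apply_apply]
  simp [Finset.filter_eq']

theorem collapse_comp_face_one {n : ℕ} (j : Fin (n + 1)) :
    (collapse (n + 1)).comp (cubeFace j 1) = (simplexFace j.castSucc).comp (collapse n) := by
  have key : ∀ (x : Cube n) (m : ℕ), initialProd (cubeFace j 1 x) m =
      initialProd x (if (j : ℕ) < m then m - 1 else m) := by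
    intro x m
    by_cases hm : m ≤ n + 1
    · rw [initialProd_cubeFace _ _ _ _ hm]
      split_ifs <;> simp
    · rw [if_pos (by lia), initialProd, if_neg hm, initialProd, if_neg (by lia)]
  ext x i
  simp only [ContinuousMap.comp_apply]
  rw [collapse_apply, key, key]
  obtain rfl | ⟨k, rfl⟩ := Fin.eq_self_or_eq_succAbove j.castSucc i
  · rw [simplexFace_same]
    simp
  · rw [simplexFace_succAbove, collapse_apply]
    congr 2 <;>
    · simp only [Fin.succAbove, Fin.lt_def]
      grind

theorem collapse_comp_face_zero_last (n : ℕ) :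
    (collapse (n + 1)).comp (cubeFace (Fin.last n) 0) =
      (simplexFace (Fin.last (n + 1))).comp (collapse n) := by
  have key : ∀ (x : Cube n) (m : ℕ), initialProd (cubeFace (Fin.last n) 0 x) m =
      initialProd x m := by
    intro x m
    by_cases hm : m ≤ n + 1
    · rw [initialProd_cubeFace _ _ _ _ hm]
      split_ifs with h
      · rw [Fin.val_last] at h
        rw [initialProd, initialProd, if_neg (by lia : ¬ m ≤ n)]
        simp
      · rfl
    · rw [initialProd, if_neg hm, initialProd, if_neg (by lia)]
  ext x i
  simp only [ContinuousMap.comp_apply]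
  rw [collapse_apply, key, key]
  obtain rfl | ⟨k, rfl⟩ := Fin.eq_self_or_eq_succAbove (Fin.last (n + 1)) i
  · rw [simplexFace_same]
    simp [initialProd]
  · rw [simplexFace_succAbove, collapse_apply]
    simp

theorem isDegenerate_comp_collapse {n : ℕ} {X : Type u} [TopologicalSpace X]
    (σ : C(Simplex (n + 1), X)) (j : Fin (n + 1)) (hj : j ≠ Fin.last n) :
    IsDegenerate ((σ.comp (collapse (n + 1))).comp (cubeFace j 0)) := by
  have hjn : (j : ℕ) < n := Fin.val_lt_last hj
  refine ⟨⟨j, hjn⟩, fun x t => ?_⟩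
  have key : ∀ m, initialProd (cubeFace j 0 (Function.update x ⟨j, hjn⟩ t)) m =
      initialProd (cubeFace j 0 x) m := by
    intro m
    by_cases hm : m ≤ n + 1
    · rw [initialProd_cubeFace _ _ _ _ hm, initialProd_cubeFace _ _ _ _ hm]
      split_ifs with h
      · simp
      · rw [initialProd, initialProd, if_pos (by lia), if_pos (by lia)]
        refine Finset.prod_congr rfl fun k _ => ?_
        by_cases hk : (k : ℕ) < m
        · rw [if_pos hk, if_pos hk, Function.update_of_ne]
          rintro rfl
          exact h hk
        · rw [if_neg hk, if_neg hk]
    · rw [initialProd, if_neg hm, initialProd, if_neg hm]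
  simp only [ContinuousMap.comp_apply]
  congr 1
  ext i
  rw [collapse_apply, collapse_apply, key, key]

theorem alternating_sum_sub {n : ℕ} {G : Type*} [AddCommGroup G] (a b : Fin (n + 1) → G)
    (c : Fin (n + 2) → G) (h1 : ∀ j : Fin (n + 1), a j = c j.castSucc)
    (h2 : b (Fin.last n) = c (Fin.last (n + 1))) (h3 : ∀ j : Fin n, b j.castSucc = 0) :
    ∑ j : Fin (n + 1), (-1 : ℤ) ^ (j : ℕ) • (a j - b j) =
      ∑ i : Fin (n + 2), (-1 : ℤ) ^ (i : ℕ) • c i := by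
  simp only [zsmul_sub, Finset.sum_sub_distrib]
  rw [Fin.sum_univ_castSucc (fun j : Fin (n + 1) => (-1 : ℤ) ^ (j : ℕ) • b j),
    Fin.sum_univ_castSucc (n := n + 1)]
  simp only [h1, h2, h3, zsmul_zero, Finset.sum_const_zero, zero_add, Fin.val_castSucc,
    Fin.val_last, pow_succ, mul_neg, mul_one, neg_zsmul, sub_eq_add_neg]

/-- Precomposition with the collapse, as a map from singular to cubical chains. -/
def collapseHom (n : ℕ) (X : Type u) [TopologicalSpace X] :
    SingChain ℝ n X →+ CubicalChain n X :=
  (QuotientAddGroup.mk' (degenerateChains n X)).comp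
    (Finsupp.mapDomain.addMonoidHom (fun σ : C(Simplex n, X) => σ.comp (collapse n)))

theorem collapseHom_single (n : ℕ) (X : Type u) [TopologicalSpace X] (σ : C(Simplex n, X))
    (a : ℝ) : collapseHom n X (Finsupp.single σ a) =
      QuotientAddGroup.mk (Finsupp.single (σ.comp (collapse n)) a) := by
  simp [collapseHom]

theorem cubicalBoundary_collapseHom (n : ℕ) (X : Type u) [TopologicalSpace X]
    (c : SingChain ℝ (n + 1) X) :
    cubicalBoundary n X (collapseHom (n + 1) X c) = collapseHom n X (singBoundary ℝ n X c) := by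
  induction c using Finsupp.induction_linear with
  | zero => simp
  | add f g hf hg => simp only [map_add, hf, hg]
  | single σ a =>
    have h1 : cubicalBoundary n X (collapseHom (n + 1) X (Finsupp.single σ a)) =
        ∑ j : Fin (n + 1), (-1 : ℤ) ^ (j : ℕ) •
          ((QuotientAddGroup.mk (Finsupp.single
              ((σ.comp (collapse (n + 1))).comp (cubeFace j 1)) a) : CubicalChain n X) -
            QuotientAddGroup.mk (Finsupp.single
              ((σ.comp (collapse (n + 1))).comp (cubeFace j 0)) a)) := by
      rw [collapseHom_single]
      change QuotientAddGroup.mk' _ (cubeBoundary n X _) = _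
      simp only [cubeBoundary, oppositeFaces, AddMonoidHom.finsetSum_apply,
        AddMonoidHom.smul_apply, AddMonoidHom.sub_apply, map_sum, map_zsmul, map_sub,
        Finsupp.mapDomain.addMonoidHom_apply, Finsupp.mapDomain_single]
      rfl
    have h2 : collapseHom n X (singBoundary ℝ n X (Finsupp.single σ a)) =
        ∑ i : Fin (n + 2), (-1 : ℤ) ^ (i : ℕ) •
          (QuotientAddGroup.mk (Finsupp.single
            (σ.comp ((simplexFace i).comp (collapse n))) a) : CubicalChain n X) := by
      simp only [singBoundary, AddMonoidHom.finsetSum_apply, AddMonoidHom.smul_apply, map_sum,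
        map_zsmul, Finsupp.mapDomain.addMonoidHom_apply, Finsupp.mapDomain_single,
        collapseHom_single]
      rfl
    have hdeg : ∀ j : Fin n, (QuotientAddGroup.mk (Finsupp.single
        ((σ.comp (collapse (n + 1))).comp (cubeFace j.castSucc 0)) a) : CubicalChain n X) = 0 :=
      fun j => (QuotientAddGroup.eq_zero_iff _).2
        (single_mem_degenerateChains (isDegenerate_comp_collapse σ _ (Fin.castSucc_lt_last j).ne) a)
    rw [h1, h2]
    refine alternating_sum_sub _ _ _ (fun j => ?_) ?_ hdeg
    · rw [ContinuousMap.comp_assoc, collapse_comp_face_one]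
    · rw [ContinuousMap.comp_assoc, collapse_comp_face_zero_last]

/-- The natural chain map from singular to cubical chains that sends a singular simplex `σ` to the
singular cube `σ ∘ collapse`. It induces the canonical natural isomorphism between singular
and cubical singular homology. -/
def singToCubical : singular.{u} ℝ ⟶ cubical.{u} where
  app X := ChainComplex.ofHom (X := singComplex ℝ X) (Y := cubicalComplex X)
    (fun n => AddCommGrpCat.ofHom (collapseHom n X))
    (fun n => by
      simp only [singComplex, cubicalComplex, ChainComplex.of_d]
      exact AddCommGrpCat.hom_ext (AddMonoidHom.ext (cubicalBoundary_collapseHom n X)))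
  naturality X Y f := by
    ext n : 1
    refine AddCommGrpCat.hom_ext (AddMonoidHom.ext fun (c : SingChain ℝ n X) => ?_)
    refine congrArg QuotientAddGroup.mk (?_ :
      Finsupp.mapDomain (fun σ : C(Simplex n, Y) => σ.comp (collapse n))
          (Finsupp.mapDomain (fun σ : C(Simplex n, X) => f.hom.comp σ) c) =
        Finsupp.mapDomain (fun σ : C(Cube n, X) => f.hom.comp σ)
          (Finsupp.mapDomain (fun σ : C(Simplex n, X) => σ.comp (collapse n)) c))
    rw [← Finsupp.mapDomain_comp, ← Finsupp.mapDomain_comp]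
    rfl

/-! ### Relative chain complexes -/

section Functorial

variable (F G : TopCat.{u} ⥤ ChainComplex AddCommGrpCat.{u} ℕ)

/-- The inclusion of a subspace. -/
def incl {X : Type u} [TopologicalSpace X] (A : Set X) : TopCat.of A ⟶ TopCat.of X :=
  TopCat.ofHom ⟨Subtype.val, continuous_subtype_val⟩

/-- The chains of `X` that come from the subspace `A`. -/
def relSubgroup {X : Type u} [TopologicalSpace X] (A : Set X) (n : ℕ) :
    AddSubgroup ((F.obj (TopCat.of X)).X n) :=
  ((F.map (incl A)).f n).hom.range

theorem relSubgroup_le_comap_d {X : Type u} [TopologicalSpace X] (A : Set X) (i j : ℕ) :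
    relSubgroup F A i ≤ (relSubgroup F A j).comap ((F.obj (TopCat.of X)).d i j).hom := by
  rintro _ ⟨a, rfl⟩
  exact ⟨((F.obj (TopCat.of A)).d i j).hom a,
    ConcreteCategory.congr_hom ((F.map (incl A)).comm i j).symm a⟩

theorem relSubgroup_mono {X : Type u} [TopologicalSpace X] {A B : Set X} (h : A ⊆ B) (n : ℕ) :
    relSubgroup F A n ≤ relSubgroup F B n := by
  rintro _ ⟨a, rfl⟩
  let k : TopCat.of A ⟶ TopCat.of B := TopCat.ofHom ⟨Set.inclusion h, continuous_inclusion h⟩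
  have hk : incl A = k ≫ incl B := rfl
  refine ⟨((F.map k).f n).hom a, ?_⟩
  rw [hk, F.map_comp]
  rfl

theorem relSubgroup_le_comap_app {F G} (ψ : F ⟶ G) {X : Type u} [TopologicalSpace X] (A : Set X)
    (n : ℕ) :
    relSubgroup F A n ≤ (relSubgroup G A n).comap ((ψ.app (TopCat.of X)).f n).hom := by
  rintro _ ⟨a, rfl⟩
  exact ⟨((ψ.app (TopCat.of A)).f n).hom a, ConcreteCategory.congr_hom
    (congrArg (fun f => HomologicalComplex.Hom.f f n) (ψ.naturality (incl A)).symm) a⟩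

/-- The relative chain complex `F(X, A) = F(X) / F(A)`. -/
def relComplex {X : Type u} [TopologicalSpace X] (A : Set X) :
    ChainComplex AddCommGrpCat.{u} ℕ where
  X n := AddCommGrpCat.of ((F.obj (TopCat.of X)).X n ⧸ relSubgroup F A n)
  d i j := AddCommGrpCat.ofHom (QuotientAddGroup.map _ _ ((F.obj (TopCat.of X)).d i j).hom
    (relSubgroup_le_comap_d F A i j))
  shape i j h := by
    refine AddCommGrpCat.hom_ext (AddMonoidHom.ext fun c => ?_)
    obtain ⟨c, rfl⟩ := QuotientAddGroup.mk_surjective c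
    exact congrArg QuotientAddGroup.mk
      (ConcreteCategory.congr_hom ((F.obj (TopCat.of X)).shape i j h) c)
  d_comp_d' i j k _ _ := by
    refine AddCommGrpCat.hom_ext (AddMonoidHom.ext fun c => ?_)
    obtain ⟨c, rfl⟩ := QuotientAddGroup.mk_surjective c
    exact congrArg QuotientAddGroup.mk
      (ConcreteCategory.congr_hom ((F.obj (TopCat.of X)).d_comp_d i j k) c)

/-- The class in `F_n(X, A)` of a chain in `F_n(X)`. -/
def relMk {X : Type u} [TopologicalSpace X] (A : Set X) {n : ℕ}
    (c : (F.obj (TopCat.of X)).X n) : (relComplex F A).X n :=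
  (QuotientAddGroup.mk c : (F.obj (TopCat.of X)).X n ⧸ relSubgroup F A n)

/-- The chain map `F(X, A) ⟶ F(X, B)` for `A ⊆ B`. -/
def relMap {X : Type u} [TopologicalSpace X] {A B : Set X} (h : A ⊆ B) :
    relComplex F A ⟶ relComplex F B where
  f n := AddCommGrpCat.ofHom (QuotientAddGroup.map _ _ (AddMonoidHom.id _)
    (relSubgroup_mono F h n))
  comm' i j _ := by
    refine AddCommGrpCat.hom_ext (AddMonoidHom.ext fun c => ?_)
    obtain ⟨c, rfl⟩ := QuotientAddGroup.mk_surjective c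
    rfl

variable {F G}

/-- The chain map `F(X, A) ⟶ G(X, A)` induced by a natural chain map `F ⟶ G`. -/
def relTrans (ψ : F ⟶ G) {X : Type u} [TopologicalSpace X] (A : Set X) :
    relComplex F A ⟶ relComplex G A where
  f n := AddCommGrpCat.ofHom (QuotientAddGroup.map _ _ ((ψ.app (TopCat.of X)).f n).hom
    (relSubgroup_le_comap_app ψ A n))
  comm' i j _ := by
    refine AddCommGrpCat.hom_ext (AddMonoidHom.ext fun c => ?_)
    obtain ⟨c, rfl⟩ := QuotientAddGroup.mk_surjective c
    exact congrArg QuotientAddGroup.mk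
      (ConcreteCategory.congr_hom ((ψ.app (TopCat.of X)).comm i j) c)

/-- The quotient semi-norm on `F_n(X, A)` induced by a norm on `F_n(X)`. -/
def relNorm (N : ∀ (X : TopCat.{u}) (n : ℕ), (F.obj X).X n → ℝ≥0∞) {X : Type u}
    [TopologicalSpace X] (A : Set X) (n : ℕ) (c : (relComplex F A).X n) : ℝ≥0∞ :=
  ⨅ (b : (F.obj (TopCat.of X)).X n) (_ : relMk F A b = c), N (TopCat.of X) n b

/-! ### Locally finite chain complexes -/

variable (F)

/-- The compatible families in `∏ K, F_n(X, X ∖ K)`, where `K` runs through the compact subsets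
of `X`, i.e., the elements of the inverse limit of the `F_n(X, X ∖ K)`. -/
def lfSubgroup (X : Type u) [TopologicalSpace X] (n : ℕ) :
    AddSubgroup (∀ K : TopologicalSpace.Compacts X, (relComplex F (K : Set X)ᶜ).X n) where
  carrier := {c | ∀ (K L : TopologicalSpace.Compacts X) (h : (K : Set X) ⊆ L),
    ((relMap F (Set.compl_subset_compl.2 h)).f n).hom (c L) = c K}
  zero_mem' K L h := map_zero _
  add_mem' ha hb K L h := by
    rw [Pi.add_apply, map_add, ha K L h, hb K L h]
    rfl
  neg_mem' ha K L h := by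
    rw [Pi.neg_apply, map_neg, ha K L h]
    rfl

/-- The locally finite chain complex `F^lf(X)`, the inverse limit of the complexes `F(X, X ∖ K)`. -/
def lfComplex (X : Type u) [TopologicalSpace X] : ChainComplex AddCommGrpCat.{u} ℕ where
  X n := AddCommGrpCat.of (lfSubgroup F X n)
  d i j := AddCommGrpCat.ofHom
    { toFun := fun c => ⟨fun K => ((relComplex F (K : Set X)ᶜ).d i j).hom (c.1 K),
        fun K L h => (ConcreteCategory.congr_hom
            ((relMap F (Set.compl_subset_compl.2 h)).comm i j).symm (c.1 L)).trans
          (congrArg ((relComplex F (K : Set X)ᶜ).d i j).hom (c.2 K L h))⟩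
      map_zero' := Subtype.ext (funext fun K => map_zero _)
      map_add' := fun a b => Subtype.ext (funext fun K => map_add _ _ _) }
  shape i j h := by
    refine AddCommGrpCat.hom_ext (AddMonoidHom.ext fun c => Subtype.ext (funext fun K => ?_))
    exact ConcreteCategory.congr_hom ((relComplex F (K : Set X)ᶜ).shape i j h) (c.1 K)
  d_comp_d' i j k _ _ := by
    refine AddCommGrpCat.hom_ext (AddMonoidHom.ext fun c => Subtype.ext (funext fun K => ?_))
    exact ConcreteCategory.congr_hom ((relComplex F (K : Set X)ᶜ).d_comp_d i j k) (c.1 K)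

/-- The component in `F_n(X, X ∖ K)` of a locally finite chain. -/
def lfComponent {X : Type u} [TopologicalSpace X] {n : ℕ} (c : (lfComplex F X).X n)
    (K : TopologicalSpace.Compacts X) : (relComplex F (K : Set X)ᶜ).X n :=
  (show lfSubgroup F X n from c).1 K

/-- The chain map `F^lf(X) ⟶ F(X, X ∖ {x})`. -/
def lfRestrict {X : Type u} [TopologicalSpace X] (x : X) :
    lfComplex F X ⟶ relComplex F ({x}ᶜ : Set X) where
  f _ := AddCommGrpCat.ofHom
    { toFun := fun c => lfComponent F c ⟨{x}, isCompact_singleton⟩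
      map_zero' := rfl
      map_add' := fun _ _ => rfl }
  comm' _ _ _ := rfl

variable {F}

/-- The chain map `F^lf(X) ⟶ G^lf(X)` induced by a natural chain map `F ⟶ G`. -/
def lfTrans (ψ : F ⟶ G) (X : Type u) [TopologicalSpace X] : lfComplex F X ⟶ lfComplex G X where
  f n := AddCommGrpCat.ofHom
    { toFun := fun c => ⟨fun K => ((relTrans ψ (K : Set X)ᶜ).f n).hom (lfComponent F c K),
        fun K L h => by
          refine Eq.trans ?_ (congrArg ((relTrans ψ (K : Set X)ᶜ).f n).hom (c.2 K L h))
          obtain ⟨b, hb⟩ := QuotientAddGroup.mk_surjective (lfComponent F c L)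
          change ((relMap G (Set.compl_subset_compl.2 h)).f n).hom
              (((relTrans ψ (L : Set X)ᶜ).f n).hom (lfComponent F c L)) =
            ((relTrans ψ (K : Set X)ᶜ).f n).hom
              (((relMap F (Set.compl_subset_compl.2 h)).f n).hom (lfComponent F c L))
          rw [← hb]
          rfl⟩
      map_zero' := Subtype.ext (funext fun K => map_zero _)
      map_add' := fun a b => Subtype.ext (funext fun K => map_add _ _ _) }
  comm' i j _ := by
    refine AddCommGrpCat.hom_ext (AddMonoidHom.ext fun c => Subtype.ext (funext fun K => ?_))
    exact ConcreteCategory.congr_hom ((relTrans ψ (K : Set X)ᶜ).comm i j) (lfComponent F c K)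

/-- The (possibly infinite) semi-norm on `F_n^lf(X)`: the infimum of `lim_K N(b_K)` over all
`N`-Cauchy families `(b_K)_K` in `F_n(X)` such that `b_K` represents the component in
`F_n(X, X ∖ K)` for all compact `K`. For singular chains, this is the `ℓ¹`-norm of the
corresponding locally finite formal sum of singular simplices. -/
def lfNorm (N : ∀ (X : TopCat.{u}) (n : ℕ), (F.obj X).X n → ℝ≥0∞) (X : Type u)
    [TopologicalSpace X] (n : ℕ) (c : (lfComplex F X).X n) : ℝ≥0∞ :=
  ⨅ (b : TopologicalSpace.Compacts X → (F.obj (TopCat.of X)).X n)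
    (_ : ∀ K : TopologicalSpace.Compacts X, relMk F (K : Set X)ᶜ (b K) = lfComponent F c K)
    (_ : ∀ ε : ℝ≥0∞, 0 < ε → ∃ K₀, ∀ K L, K₀ ≤ K → K₀ ≤ L → N (TopCat.of X) n (b K - b L) < ε)
    (l : ℝ≥0∞) (_ : Tendsto (fun K => N (TopCat.of X) n (b K)) atTop (𝓝 l)), l

end Functorial

/-- The semi-norm on the homology of a chain complex induced by a norm on its `n`-chains: the
infimum of the norms of the cycles in the given class. -/
def homologyNorm (C : ChainComplex AddCommGrpCat.{u} ℕ) (n : ℕ) (N : C.X n → ℝ≥0∞)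
    (α : C.homology n) : ℝ≥0∞ :=
  ⨅ (z : C.cycles n) (_ : (C.homologyπ n).hom z = α), N ((C.iCycles n).hom z)

/-! ### Manifolds, orientations, and fundamental classes -/

/-- The closed half-space of `ℝ^n` of points with non-negative first coordinate; for `n = 0`, this
is the one-point space `ℝ^0`. -/
abbrev HalfSpace (n : ℕ) : Type :=
  {x : EuclideanSpace ℝ (Fin n) // ∀ i : Fin n, (i : ℕ) = 0 → 0 ≤ x i}

/-- Topological `n`-manifolds with (possibly empty) boundary. -/
structure IsManifoldWithBoundary (n : ℕ) (M : Type u) [TopologicalSpace M] : Prop where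
  t2 : T2Space M
  secondCountable : SecondCountableTopology M
  exists_chart : ∀ x : M, ∃ e : OpenPartialHomeomorph M (HalfSpace n), x ∈ e.source

/-- The boundary of an `n`-manifold: the points without an open neighbourhood that is
homeomorphic to an open subset of `ℝ^n`. -/
def manifoldBoundary (n : ℕ) (M : Type u) [TopologicalSpace M] : Set M :=
  {x | ¬ ∃ e : OpenPartialHomeomorph M (EuclideanSpace ℝ (Fin n)), x ∈ e.source}

/-- Singular homology `H_n(X, A; R)`. -/
abbrev relHomology (R : Type) [Ring R] {X : Type u} [TopologicalSpace X] (A : Set X) (n : ℕ) :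
    AddCommGrpCat.{u} :=
  (relComplex (singular.{u} R) A).homology n

/-- The map `H_n(X, A; R) ⟶ H_n(X, B; R)` for `A ⊆ B`. -/
abbrev relHomologyMap (R : Type) [Ring R] {X : Type u} [TopologicalSpace X] {A B : Set X}
    (h : A ⊆ B) (n : ℕ) : relHomology R A n ⟶ relHomology R B n :=
  HomologicalComplex.homologyMap (relMap (singular.{u} R) h) n

/-- An orientation of an `n`-manifold `M`: a locally consistent choice of generators of the local
homology groups `H_n(M, M ∖ {x}; ℤ)` at the interior points `x` of `M`. -/
structure ManifoldOrientation (n : ℕ) (M : Type u) [TopologicalSpace M] where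
  localClass : ∀ x : ((manifoldBoundary n M)ᶜ : Set M), relHomology ℤ ({x.1}ᶜ : Set M) n
  isGenerator : ∀ (x : ((manifoldBoundary n M)ᶜ : Set M))
    (β : relHomology ℤ ({x.1}ᶜ : Set M) n), ∃ k : ℤ, β = k • localClass x
  locallyConsistent : ∀ x : ((manifoldBoundary n M)ᶜ : Set M),
    ∃ (U : Set M) (hU : U ⊆ (manifoldBoundary n M)ᶜ) (μ : relHomology ℤ Uᶜ n),
      IsOpen U ∧ x.1 ∈ U ∧
      ∀ (y : M) (hy : y ∈ U), (relHomologyMap ℤ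
        (Set.compl_subset_compl.2 (Set.singleton_subset_iff.2 hy)) n).hom μ =
          localClass ⟨y, hU hy⟩

section Manifold

variable {n : ℕ} {M : Type u} [TopologicalSpace M]

/-- The local orientation at `x` with real coefficients, in `H_n(M, M ∖ {x}; ℝ)`. -/
def ManifoldOrientation.realLocalClass (o : ManifoldOrientation n M)
    (x : ((manifoldBoundary n M)ᶜ : Set M)) : relHomology ℝ ({x.1}ᶜ : Set M) n :=
  (HomologicalComplex.homologyMap (relTrans intToReal ({x.1}ᶜ : Set M)) n).hom (o.localClass x)

/-- The characterisation of the (real) fundamental class `[M, ∂M] ∈ H_n(M, ∂M; ℝ)`: for every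
interior point `x`, it is mapped to the local orientation at `x` in `H_n(M, M ∖ {x}; ℝ)`. On a
compact manifold, there is exactly one such class. -/
def IsFundamentalClass (o : ManifoldOrientation n M)
    (α : relHomology ℝ (manifoldBoundary n M) n) : Prop :=
  ∀ x : ((manifoldBoundary n M)ᶜ : Set M),
    (relHomologyMap ℝ (Set.subset_compl_singleton_iff.2 x.2) n).hom α = o.realLocalClass x

/-- The characterisation of the locally finite (real) fundamental class `[M] ∈ H_n^lf(M; ℝ)` of a
manifold without boundary: for every point `x`, it is mapped to the local orientation at `x` in
`H_n(M, M ∖ {x}; ℝ)`. There is exactly one such class. -/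
def IsLfFundamentalClass (o : ManifoldOrientation n M)
    (α : (lfComplex (singular.{u} ℝ) M).homology n) : Prop :=
  ∀ x : ((manifoldBoundary n M)ᶜ : Set M),
    (HomologicalComplex.homologyMap (lfRestrict (singular.{u} ℝ) x.1) n).hom α =
      o.realLocalClass x

/-- The simplicial volume `‖M, ∂M‖`, the `ℓ¹`-semi-norm of the fundamental class. -/
def simplicialVolume (o : ManifoldOrientation n M) : ℝ≥0∞ :=
  ⨅ (α : relHomology ℝ (manifoldBoundary n M) n) (_ : IsFundamentalClass o α),
    homologyNorm _ n (relNorm singNorm (manifoldBoundary n M) n) α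

/-- The cubical simplicial volume `‖M, ∂M‖^□`, the cubical `ℓ¹`-semi-norm of the cubical
fundamental class, i.e., of the class in `H_n^□(M, ∂M; ℝ)` that corresponds to the fundamental
class. -/
def cubicalSimplicialVolume (o : ManifoldOrientation n M) : ℝ≥0∞ :=
  ⨅ (α : relHomology ℝ (manifoldBoundary n M) n) (_ : IsFundamentalClass o α),
    homologyNorm _ n (relNorm cubicalNorm (manifoldBoundary n M) n)
      ((HomologicalComplex.homologyMap (relTrans singToCubical (manifoldBoundary n M)) n).hom α)

/-- The locally finite simplicial volume `‖M‖^lf`. -/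
def lfSimplicialVolume (o : ManifoldOrientation n M) : ℝ≥0∞ :=
  ⨅ (α : (lfComplex (singular.{u} ℝ) M).homology n) (_ : IsLfFundamentalClass o α),
    homologyNorm _ n (lfNorm singNorm M n) α

/-- The locally finite cubical simplicial volume `‖M‖^{□,lf}`. -/
def lfCubicalSimplicialVolume (o : ManifoldOrientation n M) : ℝ≥0∞ :=
  ⨅ (α : (lfComplex (singular.{u} ℝ) M).homology n) (_ : IsLfFundamentalClass o α),
    homologyNorm _ n (lfNorm cubicalNorm M n)
      ((HomologicalComplex.homologyMap (lfTrans singToCubical M) n).hom α)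

end Manifold

end CubicalVolume

end

/-! The canonical map sends a simplex to a single cube, so it does not increase the `ℓ¹`-norm. In
the other direction, the `n`-cube is triangulated by coning off, from the vertex `0`, the
triangulations of its `2 n` faces. This gives a chain of norm at most `2 ^ n * n!`. The contraction
of the cube to `0` commutes with setting a coordinate to `0`, hence triangulating a degenerate cube
gives `0`, and we obtain a natural chain map from cubical to singular chains of norm at most
`2 ^ n * n!`.

Triangulating the cubes that come from simplices is a natural chain endomorphism of the singular
chains, equal to the identity in degree `0`, and so naturally homotopic to the identity by acyclic
models. Natural chain maps and homotopies pass to relative and locally finite chains, where the two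
bounds compare the semi-norms of corresponding homology classes. -/

noncomputable section

namespace CubicalVolume

universe v w

/-! ### Formal sums of maps -/

section FormalComp

variable {R : Type*} [CommSemiring R] {W X Y Z : Type*} [TopologicalSpace W] [TopologicalSpace X]
  [TopologicalSpace Y] [TopologicalSpace Z]

/-- The bilinear extension of the composition of continuous maps to formal linear combinations,
written `p ⊙ q`. A chain `u` on a model space `P` determines the natural transformation
`c ↦ c ⊙ u` on the formal sums of maps from `P` to arbitrary spaces. -/
def formalComp : (C(Y, Z) →₀ R) →ₗ[R] (C(X, Y) →₀ R) →ₗ[R] (C(X, Z) →₀ R) :=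
  Finsupp.linearCombination R fun g => Finsupp.lmapDomain R R g.comp

local infixr:75 " ⊙ " => formalComp

theorem single_formalComp (g : C(Y, Z)) (a : R) (q : C(X, Y) →₀ R) :
    Finsupp.single g a ⊙ q = a • Finsupp.mapDomain g.comp q := by
  simp [formalComp]

theorem single_one_formalComp (g : C(Y, Z)) (q : C(X, Y) →₀ R) :
    Finsupp.single g 1 ⊙ q = Finsupp.mapDomain g.comp q := by
  rw [single_formalComp, one_smul]

theorem single_formalComp_single (g : C(Y, Z)) (f : C(X, Y)) (a b : R) :
    Finsupp.single g a ⊙ Finsupp.single f b = Finsupp.single (g.comp f) (a * b) := by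
  simp [single_formalComp]

theorem formalComp_single (p : C(Y, Z) →₀ R) (f : C(X, Y)) (b : R) :
    p ⊙ Finsupp.single f b = b • Finsupp.mapDomain (fun g => g.comp f) p := by
  induction p using Finsupp.induction_linear with
  | zero => simp
  | add p p' hp hp' => simp only [map_add, LinearMap.add_apply, hp, hp', Finsupp.mapDomain_add,
      smul_add]
  | single g a => simp [single_formalComp_single, mul_comm]

theorem formalComp_assoc (p : C(Y, Z) →₀ R) (q : C(X, Y) →₀ R) (r : C(W, X) →₀ R) :
    (p ⊙ q) ⊙ r = p ⊙ q ⊙ r := by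
  induction p using Finsupp.induction_linear with
  | zero => simp
  | add p p' hp hp' => simp only [map_add, LinearMap.add_apply, hp, hp']
  | single h a =>
    induction q using Finsupp.induction_linear with
    | zero => simp
    | add q q' hq hq' => simp only [map_add, LinearMap.add_apply, hq, hq']
    | single g b =>
      simp only [single_formalComp, ← Finsupp.mapDomain_comp, Finsupp.mapDomain_smul, smul_smul,
        Finsupp.mapDomain_single, Finsupp.smul_single, smul_eq_mul]
      rfl

theorem id_formalComp (q : C(X, Y) →₀ R) :
    Finsupp.single (ContinuousMap.id Y) 1 ⊙ q = q := by
  rw [single_one_formalComp]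
  exact Finsupp.mapDomain_id

theorem formalComp_id (p : C(Y, Z) →₀ R) :
    p ⊙ Finsupp.single (ContinuousMap.id Y) 1 = p := by
  rw [formalComp_single, one_smul]
  exact Finsupp.mapDomain_id

end FormalComp

local infixr:75 " ⊙ " => formalComp

section Faces

variable {X : Type v} {Y : Type w} [TopologicalSpace X] [TopologicalSpace Y]

/-- The alternating sum of the faces of the standard `(n + 1)`-simplex. -/
def simplexFaces (R : Type) [CommRing R] (n : ℕ) : C(Simplex n, Simplex (n + 1)) →₀ R :=
  ∑ i : Fin (n + 2), Finsupp.single (simplexFace i) ((-1) ^ (i : ℕ))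

/-- The signed sum of the faces of the standard `(n + 1)`-cube. -/
def cubeFaces (n : ℕ) : C(Cube n, Cube (n + 1)) →₀ ℝ :=
  ∑ j : Fin (n + 1), (Finsupp.single (cubeFace j 1) ((-1) ^ (j : ℕ)) -
    Finsupp.single (cubeFace j 0) ((-1) ^ (j : ℕ)))

theorem singBoundary_eq_formalComp {R : Type} [CommRing R] {n : ℕ} (c : SingChain R (n + 1) X) :
    singBoundary R n X c = c ⊙ simplexFaces R n := by
  simp only [singBoundary, simplexFaces, map_sum, formalComp_single, AddMonoidHom.finsetSum_apply,
    AddMonoidHom.smul_apply, Finsupp.mapDomain.addMonoidHom_apply, ← Int.cast_smul_eq_zsmul R,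
    Int.cast_pow, Int.cast_neg, Int.cast_one]

theorem cubeBoundary_eq_formalComp {n : ℕ} (q : CubeChain (n + 1) X) :
    cubeBoundary n X q = q ⊙ cubeFaces n := by
  simp only [cubeBoundary, oppositeFaces, cubeFaces, map_sum, map_sub, formalComp_single,
    AddMonoidHom.finsetSum_apply, AddMonoidHom.smul_apply, AddMonoidHom.sub_apply,
    Finsupp.mapDomain.addMonoidHom_apply, ← Int.cast_smul_eq_zsmul ℝ, Int.cast_pow, Int.cast_neg,
    Int.cast_one, smul_sub]

theorem singBoundary_formalComp {R : Type} [CommRing R] {n : ℕ} (p : C(X, Y) →₀ R)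
    (c : SingChain R (n + 1) X) :
    singBoundary R n Y (p ⊙ c) = p ⊙ singBoundary R n X c := by
  simp only [singBoundary_eq_formalComp, formalComp_assoc]

theorem singBoundary_id {R : Type} [CommRing R] (n : ℕ) :
    singBoundary R n _ (Finsupp.single (ContinuousMap.id _) 1) = simplexFaces R n := by
  rw [singBoundary_eq_formalComp, id_formalComp]

theorem simplexFaces_formalComp_simplexFaces (R : Type) [CommRing R] (n : ℕ) :
    simplexFaces R (n + 1) ⊙ simplexFaces R n = 0 := by
  rw [← singBoundary_eq_formalComp, ← singBoundary_id (n + 1), singBoundary_singBoundary]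

theorem cubeFaces_formalComp_cubeFaces (n : ℕ) : cubeFaces (n + 1) ⊙ cubeFaces n = 0 := by
  have h := cubeBoundary_cubeBoundary n _ (Finsupp.single (ContinuousMap.id (Cube (n + 2))) 1)
  rwa [cubeBoundary_eq_formalComp, cubeBoundary_eq_formalComp, id_formalComp] at h

end Faces

/-! ### Cones -/

section SimplexJoin

variable {n : ℕ}

/-- The map `(t, s) ↦ (t, (1 - t) s)` that exhibits the `(n + 1)`-simplex as the cone with apex
the zeroth vertex, at `t = 1`, over its zeroth face, at `t = 0`. -/
def simplexJoin (n : ℕ) : C(unitInterval × Simplex n, Simplex (n + 1)) where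
  toFun p := ⟨Fin.cons (p.1 : ℝ) fun i => (1 - (p.1 : ℝ)) * p.2 i,
    Fin.cases p.1.2.1 fun i => mul_nonneg (sub_nonneg.2 p.1.2.2) (p.2.2.1 i), by
      rw [Fin.sum_univ_succ]
      simp only [Fin.cons_zero, Fin.cons_succ, ← Finset.mul_sum]
      rw [show ∑ i, p.2 i = 1 from p.2.2.2, mul_one, add_sub_cancel]⟩
  continuous_toFun := by
    refine Continuous.subtype_mk (continuous_pi (Fin.cases ?_ fun i => ?_)) _
    · simp only [Fin.cons_zero]
      fun_prop
    · have : Continuous fun p : unitInterval × Simplex n => p.2 i :=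
        (continuous_apply i).comp (continuous_subtype_val.comp continuous_snd)
      simp only [Fin.cons_succ]
      fun_prop

theorem simplexJoin_zero (t : unitInterval) (s : Simplex n) : simplexJoin n (t, s) 0 = t := rfl

theorem simplexJoin_succ (t : unitInterval) (s : Simplex n) (i : Fin (n + 1)) :
    simplexJoin n (t, s) i.succ = (1 - (t : ℝ)) * s i := rfl

theorem simplexJoin_surjective (n : ℕ) : Function.Surjective (simplexJoin n) := by
  intro y
  have hnonneg : ∀ i, 0 ≤ y i := y.2.1
  have hsum : ∑ i : Fin (n + 1), y i.succ = 1 - y 0 :=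
    eq_sub_of_add_eq' ((Fin.sum_univ_succ y).symm.trans y.2.2)
  have hle : 0 ≤ 1 - y 0 := hsum ▸ Finset.sum_nonneg fun i _ => hnonneg _
  by_cases h : 1 - y 0 = 0
  · refine ⟨(1, stdSimplex.vertex 0), ?_⟩
    ext i
    refine Fin.cases (sub_eq_zero.1 h) (fun j => ?_) i
    have hj := (Finset.sum_eq_zero_iff_of_nonneg fun i _ => hnonneg _).1 (hsum.trans h) j
      (Finset.mem_univ j)
    rw [simplexJoin_succ, hj]
    simp
  · refine ⟨(⟨y 0, hnonneg 0, sub_nonneg.1 hle⟩, ⟨fun i => y i.succ / (1 - y 0), fun i =>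
      div_nonneg (hnonneg _) hle, by rw [← Finset.sum_div, hsum, div_self h]⟩), ?_⟩
    ext i
    exact Fin.cases rfl (fun j => mul_div_cancel₀ _ h) i

theorem isQuotientMap_simplexJoin (n : ℕ) : IsQuotientMap (simplexJoin n) :=
  (simplexJoin n).continuous.isClosedMap.isQuotientMap (simplexJoin n).continuous
    (simplexJoin_surjective n)

theorem simplexJoin_eq_imp {t t' : unitInterval} {s s' : Simplex n}
    (h : simplexJoin n (t, s) = simplexJoin n (t', s')) : t = t' ∧ (t = 1 ∨ s = s') := by
  have ht : t = t' := Subtype.ext (congrArg (fun y : Simplex (n + 1) => y 0) h)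
  refine ⟨ht, or_iff_not_imp_left.2 fun ht1 => stdSimplex.ext (funext fun i => ?_)⟩
  subst ht
  exact mul_left_cancel₀ (sub_ne_zero.2 fun h1 => ht1 (Subtype.ext h1.symm))
    (congrArg (fun y : Simplex (n + 1) => y i.succ) h)

theorem simplexFace_zero_eq_simplexJoin (s : Simplex n) :
    simplexFace 0 s = simplexJoin n (0, s) := by
  ext i
  refine Fin.cases ?_ (fun j => ?_) i
  · rw [simplexFace_same, simplexJoin_zero, Set.Icc.coe_zero]
  · rw [simplexJoin_succ, ← Fin.succAbove_zero, simplexFace_succAbove, Set.Icc.coe_zero,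
      sub_zero, one_mul]

theorem simplexFace_succ_simplexJoin (i : Fin (n + 2)) (t : unitInterval) (s : Simplex n) :
    simplexFace i.succ (simplexJoin n (t, s)) = simplexJoin (n + 1) (t, simplexFace i s) := by
  ext k
  obtain rfl | ⟨k, rfl⟩ := Fin.eq_self_or_eq_succAbove i.succ k
  · rw [simplexFace_same, simplexJoin_succ, simplexFace_same, mul_zero]
  rw [simplexFace_succAbove]
  refine Fin.cases ?_ (fun j => ?_) k
  · rw [Fin.succ_succAbove_zero, simplexJoin_zero, simplexJoin_zero]
  · rw [Fin.succ_succAbove_succ, simplexJoin_succ, simplexJoin_succ, simplexFace_succAbove]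

theorem simplexFace_one_eq_simplexJoin (s : Simplex 0) :
    simplexFace 1 s = simplexJoin 0 (1, s) := by
  ext i
  refine Fin.cases ?_ (fun j => ?_) i
  · rw [simplexJoin_zero, show (0 : Fin 2) = Fin.succAbove 1 0 from rfl, simplexFace_succAbove]
    simp
  · rw [simplexJoin_succ, Subsingleton.elim j 0, show Fin.succ (0 : Fin 1) = 1 from rfl,
      simplexFace_same]
    simp

end SimplexJoin

section Cone

variable {R : Type} [CommRing R] {X : Type v} [TopologicalSpace X] {b : X}
  (H : (ContinuousMap.id X).Homotopy (ContinuousMap.const X b)) {n : ℕ}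

/-- The cone over a singular simplex `σ` with respect to a contraction `H`: the singular simplex
that takes the value `H (t, σ s)` at `simplexJoin n (t, s)`. -/
def coneSimplex (σ : C(Simplex n, X)) : C(Simplex (n + 1), X) :=
  (isQuotientMap_simplexJoin n).lift
    (H.toContinuousMap.comp ((ContinuousMap.id unitInterval).prodMap σ)) (by
      rintro ⟨t, s⟩ ⟨t', s'⟩ h
      obtain ⟨rfl, rfl | rfl⟩ := simplexJoin_eq_imp h
      · change H (1, σ s) = H (1, σ s')
        rw [H.apply_one, H.apply_one, ContinuousMap.const_apply, ContinuousMap.const_apply]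
      · rfl)

theorem coneSimplex_simplexJoin (σ : C(Simplex n, X)) (t : unitInterval) (s : Simplex n) :
    coneSimplex H σ (simplexJoin n (t, s)) = H (t, σ s) :=
  DFunLike.congr_fun ((isQuotientMap_simplexJoin n).lift_comp _ _ :
    (coneSimplex H σ).comp (simplexJoin n) = _) (t, s)

theorem coneSimplex_comp_simplexFace_zero (σ : C(Simplex n, X)) :
    (coneSimplex H σ).comp (simplexFace 0) = σ := by
  ext1 s
  rw [ContinuousMap.comp_apply, simplexFace_zero_eq_simplexJoin, coneSimplex_simplexJoin,
    H.apply_zero, ContinuousMap.id_apply]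

theorem coneSimplex_comp_simplexFace_succ (σ : C(Simplex (n + 1), X)) (i : Fin (n + 2)) :
    (coneSimplex H σ).comp (simplexFace i.succ) = coneSimplex H (σ.comp (simplexFace i)) := by
  ext1 y
  obtain ⟨⟨t, s⟩, rfl⟩ := simplexJoin_surjective n y
  rw [ContinuousMap.comp_apply, simplexFace_succ_simplexJoin, coneSimplex_simplexJoin,
    coneSimplex_simplexJoin, ContinuousMap.comp_apply]

theorem coneSimplex_comp_simplexFace_one (σ : C(Simplex 0, X)) :
    (coneSimplex H σ).comp (simplexFace 1) = ContinuousMap.const _ b := by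
  ext1 s
  rw [ContinuousMap.comp_apply, simplexFace_one_eq_simplexJoin, coneSimplex_simplexJoin,
    H.apply_one, ContinuousMap.const_apply, ContinuousMap.const_apply]

theorem comp_coneSimplex {Y : Type w} [TopologicalSpace Y] {b' : Y}
    (H' : (ContinuousMap.id Y).Homotopy (ContinuousMap.const Y b')) (f : C(X, Y))
    (hf : ∀ t x, f (H (t, x)) = H' (t, f x)) (σ : C(Simplex n, X)) :
    f.comp (coneSimplex H σ) = coneSimplex H' (f.comp σ) := by
  ext1 y
  obtain ⟨⟨t, s⟩, rfl⟩ := simplexJoin_surjective n y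
  rw [ContinuousMap.comp_apply, coneSimplex_simplexJoin, coneSimplex_simplexJoin, hf,
    ContinuousMap.comp_apply]

/-- The cone over a singular chain with respect to a contraction. -/
def cone : SingChain R n X →ₗ[R] SingChain R (n + 1) X :=
  Finsupp.lmapDomain R R (coneSimplex H)

theorem cone_single (σ : C(Simplex n, X)) (a : R) :
    cone H (Finsupp.single σ a) = Finsupp.single (coneSimplex H σ) a :=
  Finsupp.mapDomain_single

theorem singBoundary_single (σ : C(Simplex (n + 1), X)) (a : R) :
    singBoundary R n X (Finsupp.single σ a) =
      ∑ i : Fin (n + 2), Finsupp.single (σ.comp (simplexFace i)) (a * (-1) ^ (i : ℕ)) := by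
  simp only [singBoundary_eq_formalComp, simplexFaces, map_sum, single_formalComp_single]

theorem singBoundary_cone (c : SingChain R (n + 1) X) :
    singBoundary R (n + 1) X (cone H c) = c - cone H (singBoundary R n X c) := by
  induction c using Finsupp.induction_linear with
  | zero => simp
  | add c d hc hd => simp only [map_add, hc, hd, add_sub_add_comm]
  | single σ a =>
    rw [cone_single, singBoundary_single, Fin.sum_univ_succ, coneSimplex_comp_simplexFace_zero,
      singBoundary_single, map_sum]
    simp only [cone_single, coneSimplex_comp_simplexFace_succ, Fin.val_zero, pow_zero, mul_one,
      Fin.val_succ, pow_succ, mul_neg, Finsupp.single_neg, Finset.sum_neg_distrib, sub_eq_add_neg]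

theorem singBoundary_cone_zero (c : SingChain R 0 X) :
    singBoundary R 0 X (cone H c) =
      c - Finsupp.single (ContinuousMap.const _ b) (c.sum fun _ a => a) := by
  induction c using Finsupp.induction_linear with
  | zero => simp
  | add c d hc hd =>
    rw [Finsupp.sum_add_index' (fun _ => rfl) (fun _ _ _ => rfl), Finsupp.single_add, map_add,
      map_add, hc, hd, add_sub_add_comm]
  | single σ a =>
    rw [cone_single, singBoundary_single, Fin.sum_univ_two, coneSimplex_comp_simplexFace_zero,
      coneSimplex_comp_simplexFace_one, Finsupp.sum_single_index rfl]
    simp [sub_eq_add_neg]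

theorem single_formalComp_cone {Y : Type w} [TopologicalSpace Y] {b' : Y}
    (H' : (ContinuousMap.id Y).Homotopy (ContinuousMap.const Y b')) (f : C(X, Y))
    (hf : ∀ t x, f (H (t, x)) = H' (t, f x)) (c : SingChain R n X) :
    Finsupp.single f 1 ⊙ cone H c = cone H' (Finsupp.single f 1 ⊙ c) := by
  simp only [single_one_formalComp, cone, Finsupp.lmapDomain_apply, ← Finsupp.mapDomain_comp]
  exact congrArg (Finsupp.mapDomain · c) (funext (comp_coneSimplex H H' f hf))

end Cone

/-! ### The triangulation of the cube -/

section Triangulation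

variable {X : Type v} [TopologicalSpace X] {n : ℕ}

/-- The linear contraction of the cube to the vertex `0`. -/
def cubeContraction (n : ℕ) :
    (ContinuousMap.id (Cube n)).Homotopy (ContinuousMap.const (Cube n) 0) where
  toFun p i := unitInterval.symm p.1 * p.2 i
  continuous_toFun := by fun_prop
  map_zero_left x := by funext i; simp
  map_one_left x := by funext i; simp

/-- The triangulation of the cube, as a singular chain: the cone with apex the vertex `0` over the
triangulations of the faces. -/
def cubeTriangulation : ∀ n : ℕ, SingChain ℝ n (Cube n)
  | 0 => Finsupp.single (ContinuousMap.const _ 0) 1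
  | n + 1 => cone (cubeContraction (n + 1)) (cubeFaces n ⊙ cubeTriangulation n)

theorem singBoundary_cubeTriangulation (n : ℕ) :
    singBoundary ℝ n (Cube (n + 1)) (cubeTriangulation (n + 1)) =
      cubeFaces n ⊙ cubeTriangulation n := by
  induction n with
  | zero =>
    rw [cubeTriangulation.eq_2, singBoundary_cone_zero, sub_eq_self, Finsupp.single_eq_zero,
      cubeFaces, Fin.sum_univ_one, map_sub, LinearMap.sub_apply, cubeTriangulation,
      single_formalComp_single, single_formalComp_single, Finsupp.sum_sub_index fun _ _ _ => rfl,
      Finsupp.sum_single_index rfl, Finsupp.sum_single_index rfl, sub_self]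
  | succ n ih =>
    rw [cubeTriangulation, singBoundary_cone, singBoundary_formalComp, ih, ← formalComp_assoc,
      cubeFaces_formalComp_cubeFaces, map_zero, LinearMap.zero_apply, map_zero, sub_zero]

theorem singBoundary_formalComp_cubeTriangulation (q : CubeChain (n + 1) X) :
    singBoundary ℝ n X (q ⊙ cubeTriangulation (n + 1)) =
      cubeBoundary n X q ⊙ cubeTriangulation n := by
  rw [singBoundary_formalComp, singBoundary_cubeTriangulation, ← formalComp_assoc,
    cubeBoundary_eq_formalComp]

/-- The map of the cube that replaces the `j`-th coordinate by `0`. -/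
def coordZero (j : Fin n) : C(Cube n, Cube n) :=
  ⟨fun x => Function.update x j 0, by fun_prop⟩

theorem coordZero_cubeContraction (j : Fin n) (t : unitInterval) (x : Cube n) :
    coordZero j (cubeContraction n (t, x)) = cubeContraction n (t, coordZero j x) := by
  funext i
  change Function.update (fun i => unitInterval.symm t * x i) j 0 i =
    unitInterval.symm t * Function.update x j 0 i
  obtain rfl | h := eq_or_ne i j
  · rw [Function.update_self, Function.update_self, mul_zero]
  · rw [Function.update_of_ne h, Function.update_of_ne h]

theorem coordZero_comp_cubeFace_same (j : Fin (n + 1)) (e : unitInterval) :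
    (coordZero j).comp (cubeFace j e) = cubeFace j 0 :=
  ContinuousMap.ext fun x => Fin.update_insertNth (α := fun _ => unitInterval) j e 0 x

theorem coordZero_comp_cubeFace_succAbove (k : Fin (n + 1)) (i : Fin n) (e : unitInterval) :
    (coordZero (k.succAbove i)).comp (cubeFace k e) = (cubeFace k e).comp (coordZero i) :=
  ContinuousMap.ext fun x =>
    (Fin.insertNth_update (α := fun _ => unitInterval) k e i 0 x).symm

theorem coordZero_formalComp_cubeTriangulation (j : Fin n) :
    Finsupp.single (coordZero j) 1 ⊙ cubeTriangulation n = 0 := by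
  induction n with
  | zero => exact j.elim0
  | succ n ih =>
    suffices h : Finsupp.single (coordZero j) 1 ⊙ cubeFaces n ⊙ cubeTriangulation n = 0 by
      rw [cubeTriangulation, single_formalComp_cone _ _ _ (coordZero_cubeContraction j), h,
        map_zero]
    simp only [cubeFaces, map_sum, map_sub, LinearMap.sum_apply, LinearMap.sub_apply,
      ← formalComp_assoc, single_formalComp_single, one_mul]
    refine Finset.sum_eq_zero fun k _ => ?_
    obtain rfl | ⟨i, rfl⟩ := Fin.eq_self_or_eq_succAbove k j
    · rw [coordZero_comp_cubeFace_same, coordZero_comp_cubeFace_same, sub_self]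
    · have hface (e : unitInterval) (a : ℝ) : Finsupp.single
          ((coordZero (k.succAbove i)).comp (cubeFace k e)) a ⊙ cubeTriangulation n = 0 := by
        rw [coordZero_comp_cubeFace_succAbove, ← mul_one a, ← single_formalComp_single,
          formalComp_assoc, ih, map_zero]
      rw [hface, hface, sub_zero]

theorem IsDegenerate.exists_eq_comp_coordZero {c : C(Cube n, X)} (hc : IsDegenerate c) :
    ∃ j, c = c.comp (coordZero j) :=
  hc.imp fun _ h => ContinuousMap.ext fun x => (h x 0).symm

theorem IsDegenerate.single_formalComp_cubeTriangulation {c : C(Cube n, X)}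
    (hc : IsDegenerate c) (a : ℝ) : Finsupp.single c a ⊙ cubeTriangulation n = 0 := by
  obtain ⟨j, hj⟩ := hc.exists_eq_comp_coordZero
  rw [hj, ← mul_one a, ← single_formalComp_single, formalComp_assoc,
    coordZero_formalComp_cubeTriangulation, map_zero]

/-- The map from cubical to singular chains that triangulates each singular cube. -/
def triangulate (n : ℕ) (X : Type v) [TopologicalSpace X] : CubicalChain n X →+ SingChain ℝ n X :=
  QuotientAddGroup.lift (degenerateChains n X)
    (formalComp.flip (cubeTriangulation n)).toAddMonoidHom <| by
      refine (AddSubgroup.closure_le _).2 ?_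
      rintro _ ⟨c, a, hc, rfl⟩
      exact hc.single_formalComp_cubeTriangulation a

theorem triangulate_mk (q : CubeChain n X) :
    triangulate n X (QuotientAddGroup.mk q) = q ⊙ cubeTriangulation n := rfl

theorem singBoundary_triangulate (c : CubicalChain (n + 1) X) :
    singBoundary ℝ n X (triangulate (n + 1) X c) = triangulate n X (cubicalBoundary n X c) := by
  obtain ⟨q, rfl⟩ := QuotientAddGroup.mk_surjective c
  exact singBoundary_formalComp_cubeTriangulation q

theorem triangulate_collapseHom (c : SingChain ℝ n X) :
    triangulate n X (collapseHom n X c) =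
      c ⊙ Finsupp.single (collapse n) 1 ⊙ cubeTriangulation n := by
  induction c using Finsupp.induction_linear with
  | zero => simp
  | add c d hc hd => simp only [map_add, LinearMap.add_apply, hc, hd]
  | single σ a =>
    rw [collapseHom_single, triangulate_mk, ← formalComp_assoc, single_formalComp_single, mul_one]

theorem singMap_eq_formalComp {R : Type} [CommRing R] {X Y : Type u} [TopologicalSpace X]
    [TopologicalSpace Y] (f : C(X, Y)) (c : SingChain R n X) :
    singMap R n f c = Finsupp.single f 1 ⊙ c :=
  (single_one_formalComp f c).symm

theorem triangulate_cubicalMap {X Y : Type u} [TopologicalSpace X] [TopologicalSpace Y]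
    (f : C(X, Y)) (c : CubicalChain n X) :
    triangulate n Y (cubicalMap n f c) = singMap ℝ n f (triangulate n X c) := by
  obtain ⟨q, rfl⟩ := QuotientAddGroup.mk_surjective c
  change triangulate n Y (QuotientAddGroup.mk (Finsupp.mapDomain f.comp q)) = _
  rw [triangulate_mk, triangulate_mk, singMap_eq_formalComp, ← formalComp_assoc,
    single_one_formalComp]

/-- The natural chain map from cubical to singular chains that triangulates each singular cube. -/
def cubicalToSing : cubical.{u} ⟶ singular.{u} ℝ where
  app X := ChainComplex.ofHom (X := cubicalComplex X) (Y := singComplex ℝ X)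
    (fun n => AddCommGrpCat.ofHom (triangulate n X))
    (fun n => by
      simp only [singComplex, cubicalComplex, ChainComplex.of_d]
      exact AddCommGrpCat.hom_ext (AddMonoidHom.ext singBoundary_triangulate))
  naturality _ _ f := by
    ext n : 1
    exact AddCommGrpCat.hom_ext (AddMonoidHom.ext (triangulate_cubicalMap f.hom))

end Triangulation

/-! ### Natural chain homotopies -/

/-- A chain homotopy between natural chain maps that is itself natural. -/
structure NaturalHomotopy {T V ι : Type*} [Category* T] [Category* V] [Preadditive V]
    {c : ComplexShape ι} {F G : T ⥤ HomologicalComplex V c} (f g : F ⟶ G) where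
  homotopy (X : T) : Homotopy (f.app X) (g.app X)
  naturality {X Y : T} (k : X ⟶ Y) (i j : ι) :
    (homotopy X).hom i j ≫ (G.map k).f j = (F.map k).f i ≫ (homotopy Y).hom i j

/-- The chain homotopy of chain complexes with the given components of degree one. -/
def homotopyOfComponents {V : Type*} [Category* V] [Preadditive V] {C D : ChainComplex V ℕ}
    {f g : C ⟶ D} (s : ∀ n, C.X n ⟶ D.X (n + 1)) (h_zero : f.f 0 = s 0 ≫ D.d 1 0 + g.f 0)
    (h_succ : ∀ n, f.f (n + 1) =
      C.d (n + 1) n ≫ s n + s (n + 1) ≫ D.d (n + 2) (n + 1) + g.f (n + 1)) :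
    Homotopy f g where
  hom i j := if h : i + 1 = j then s i ≫ eqToHom (congrArg D.X h) else 0
  zero _ _ h := dif_neg h
  comm
    | 0 => by
      rw [Homotopy.dNext_zero_chainComplex, Homotopy.prevD_chainComplex, h_zero]
      simp
    | n + 1 => by
      rw [Homotopy.dNext_succ_chainComplex, Homotopy.prevD_chainComplex, h_succ]
      simp

section RelativeAndLocallyFinite

variable {E F G : TopCat.{u} ⥤ ChainComplex AddCommGrpCat.{u} ℕ} {X : Type u} [TopologicalSpace X]

theorem relTrans_id (A : Set X) : relTrans (𝟙 F) A = 𝟙 (relComplex F A) := by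
  ext n : 1
  refine AddCommGrpCat.hom_ext (AddMonoidHom.ext fun c => ?_)
  obtain ⟨c, rfl⟩ := QuotientAddGroup.mk_surjective c
  rfl

theorem relTrans_comp (f : E ⟶ F) (g : F ⟶ G) (A : Set X) :
    relTrans (f ≫ g) A = relTrans f A ≫ relTrans g A := by
  ext n : 1
  refine AddCommGrpCat.hom_ext (AddMonoidHom.ext fun c => ?_)
  obtain ⟨c, rfl⟩ := QuotientAddGroup.mk_surjective c
  rfl

theorem lfTrans_id (F : TopCat.{u} ⥤ ChainComplex AddCommGrpCat.{u} ℕ) (X : Type u)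
    [TopologicalSpace X] : lfTrans (𝟙 F) X = 𝟙 (lfComplex F X) := by
  ext n : 1
  refine AddCommGrpCat.hom_ext (AddMonoidHom.ext fun c => Subtype.ext (funext fun K => ?_))
  exact ConcreteCategory.congr_hom (congrArg (fun k => HomologicalComplex.Hom.f k n)
    (relTrans_id (K : Set X)ᶜ)) (lfComponent F c K)

theorem lfTrans_comp (f : E ⟶ F) (g : F ⟶ G) (X : Type u) [TopologicalSpace X] :
    lfTrans (f ≫ g) X = lfTrans f X ≫ lfTrans g X := by
  ext n : 1
  refine AddCommGrpCat.hom_ext (AddMonoidHom.ext fun c => Subtype.ext (funext fun K => ?_))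
  exact ConcreteCategory.congr_hom (congrArg (fun k => HomologicalComplex.Hom.f k n)
    (relTrans_comp f g (K : Set X)ᶜ)) (lfComponent E c K)

namespace NaturalHomotopy

variable {f g : F ⟶ G} (h : NaturalHomotopy f g)

theorem relSubgroup_le_comap (A : Set X) (i j : ℕ) :
    relSubgroup F A i ≤ (relSubgroup G A j).comap ((h.homotopy (TopCat.of X)).hom i j).hom := by
  rintro _ ⟨a, rfl⟩
  exact ⟨((h.homotopy (TopCat.of A)).hom i j).hom a,
    ConcreteCategory.congr_hom (h.naturality (incl A) i j) a⟩

/-- The homotopy of relative chain maps induced by a natural chain homotopy. -/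
def rel (A : Set X) : Homotopy (relTrans f A) (relTrans g A) where
  hom i j := AddCommGrpCat.ofHom (QuotientAddGroup.map _ _
    ((h.homotopy (TopCat.of X)).hom i j).hom (h.relSubgroup_le_comap A i j))
  zero i j hij := by
    refine AddCommGrpCat.hom_ext (AddMonoidHom.ext fun c => ?_)
    obtain ⟨c, rfl⟩ := QuotientAddGroup.mk_surjective c
    exact congrArg QuotientAddGroup.mk
      (ConcreteCategory.congr_hom ((h.homotopy (TopCat.of X)).zero i j hij) c)
  comm i := by
    refine AddCommGrpCat.hom_ext (AddMonoidHom.ext fun c => ?_)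
    obtain ⟨c, rfl⟩ := QuotientAddGroup.mk_surjective c
    exact congrArg QuotientAddGroup.mk
      (ConcreteCategory.congr_hom ((h.homotopy (TopCat.of X)).comm i) c)

theorem relMap_rel {A B : Set X} (hAB : A ⊆ B) (i j : ℕ) (c : (relComplex F A).X i) :
    ((relMap G hAB).f j).hom (((h.rel A).hom i j).hom c) =
      ((h.rel B).hom i j).hom (((relMap F hAB).f i).hom c) := by
  obtain ⟨c, rfl⟩ := QuotientAddGroup.mk_surjective c
  rfl

/-- The homotopy of locally finite chain maps induced by a natural chain homotopy. -/
def lf (X : Type u) [TopologicalSpace X] : Homotopy (lfTrans f X) (lfTrans g X) where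
  hom i j := AddCommGrpCat.ofHom
    { toFun := fun c => ⟨fun K => ((h.rel (K : Set X)ᶜ).hom i j).hom (lfComponent F c K),
        fun K L hKL => (h.relMap_rel (Set.compl_subset_compl.2 hKL) i j _).trans
          (congrArg ((h.rel (K : Set X)ᶜ).hom i j).hom (c.2 K L hKL))⟩
      map_zero' := Subtype.ext (funext fun K => map_zero _)
      map_add' := fun a b => Subtype.ext (funext fun K => map_add _ _ _) }
  zero i j hij := by
    refine AddCommGrpCat.hom_ext (AddMonoidHom.ext fun c => Subtype.ext (funext fun K => ?_))
    exact ConcreteCategory.congr_hom ((h.rel (K : Set X)ᶜ).zero i j hij) (lfComponent F c K)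
  comm i := by
    refine AddCommGrpCat.hom_ext (AddMonoidHom.ext fun c => Subtype.ext (funext fun K => ?_))
    exact ConcreteCategory.congr_hom ((h.rel (K : Set X)ᶜ).comm i) (lfComponent F c K)

theorem homologyMap_relTrans_comp {f : F ⟶ G} {g : G ⟶ F} (h : NaturalHomotopy (f ≫ g) (𝟙 F))
    (A : Set X) (n : ℕ) : HomologicalComplex.homologyMap (relTrans f A) n ≫
      HomologicalComplex.homologyMap (relTrans g A) n = 𝟙 _ := by
  rw [← HomologicalComplex.homologyMap_comp, ← relTrans_comp, (h.rel A).homologyMap_eq,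
    relTrans_id, HomologicalComplex.homologyMap_id]

theorem homologyMap_lfTrans_comp {f : F ⟶ G} {g : G ⟶ F} (h : NaturalHomotopy (f ≫ g) (𝟙 F))
    (X : Type u) [TopologicalSpace X] (n : ℕ) : HomologicalComplex.homologyMap (lfTrans f X) n ≫
      HomologicalComplex.homologyMap (lfTrans g X) n = 𝟙 _ := by
  rw [← HomologicalComplex.homologyMap_comp, ← lfTrans_comp, (h.lf X).homologyMap_eq,
    lfTrans_id, HomologicalComplex.homologyMap_id]

end NaturalHomotopy

end RelativeAndLocallyFinite

/-! ### Natural chain maps on singular chains that agree in degree zero -/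

section Models

variable {R : Type} [CommRing R] {X : Type v} [TopologicalSpace X] {n : ℕ}

theorem exists_simplexContraction (n : ℕ) : Nonempty (Σ b : Simplex n,
    (ContinuousMap.id (Simplex n)).Homotopy (ContinuousMap.const (Simplex n) b)) := by
  have : ContractibleSpace (Simplex n) :=
    (convex_stdSimplex ℝ (Fin (n + 1))).contractibleSpace ⟨_, (stdSimplex.vertex 0).2⟩
  obtain ⟨b, ⟨H⟩⟩ := id_nullhomotopic (Simplex n)
  exact ⟨⟨b, H⟩⟩

/-- A contraction of the standard simplex. -/
def simplexContraction (n : ℕ) : Σ b : Simplex n,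
    (ContinuousMap.id (Simplex n)).Homotopy (ContinuousMap.const (Simplex n) b) :=
  (exists_simplexContraction n).some

/-- The condition that `c ↦ c ⊙ φ n` is a chain map on singular chains. -/
def IsModelChainMap (φ : ∀ n, SingChain R n (Simplex n)) : Prop :=
  ∀ n, singBoundary R n _ (φ (n + 1)) = simplexFaces R n ⊙ φ n

variable (φ ψ : ∀ n, SingChain R n (Simplex n))

/-- The chains on the models of the natural homotopy between the natural chain maps `c ↦ c ⊙ φ n`
and `c ↦ c ⊙ ψ n`, constructed by coning off the chains that have to be bounded. -/
def modelHomotopy : ∀ n : ℕ, SingChain R (n + 1) (Simplex n)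
  | 0 => 0
  | n + 1 => cone (simplexContraction (n + 1)).2
      (φ (n + 1) - ψ (n + 1) - simplexFaces R n ⊙ modelHomotopy n)

variable {φ ψ}

theorem singBoundary_modelHomotopy (hφ : IsModelChainMap φ) (hψ : IsModelChainMap ψ)
    (h_zero : φ 0 = ψ 0) (n : ℕ) :
    singBoundary R (n + 1) _ (modelHomotopy φ ψ (n + 1)) =
      φ (n + 1) - ψ (n + 1) - simplexFaces R n ⊙ modelHomotopy φ ψ n := by
  have boundary_of_cycle (m : ℕ) (h : singBoundary R m _
      (φ (m + 1) - ψ (m + 1) - simplexFaces R m ⊙ modelHomotopy φ ψ m) = 0) :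
      singBoundary R (m + 1) _ (modelHomotopy φ ψ (m + 1)) =
        φ (m + 1) - ψ (m + 1) - simplexFaces R m ⊙ modelHomotopy φ ψ m := by
    rw [modelHomotopy, singBoundary_cone, h, map_zero, sub_zero]
  induction n with
  | zero =>
    refine boundary_of_cycle 0 ?_
    rw [map_sub, map_sub, hφ, hψ, h_zero, modelHomotopy, map_zero, map_zero, sub_self, sub_zero]
  | succ n ih =>
    refine boundary_of_cycle (n + 1) ?_
    rw [map_sub, map_sub, hφ, hψ, singBoundary_formalComp, ih, map_sub, map_sub,
      ← formalComp_assoc _ _ (modelHomotopy φ ψ n), simplexFaces_formalComp_simplexFaces,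
      map_zero, LinearMap.zero_apply, sub_zero, sub_self]

theorem singBoundary_formalComp_modelHomotopy (hφ : IsModelChainMap φ) (hψ : IsModelChainMap ψ)
    (h_zero : φ 0 = ψ 0) (c : SingChain R (n + 1) X) :
    c ⊙ φ (n + 1) = singBoundary R n X c ⊙ modelHomotopy φ ψ n +
      singBoundary R (n + 1) X (c ⊙ modelHomotopy φ ψ (n + 1)) + c ⊙ ψ (n + 1) := by
  rw [singBoundary_formalComp, singBoundary_modelHomotopy hφ hψ h_zero, map_sub, map_sub,
    singBoundary_eq_formalComp, formalComp_assoc]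
  abel

theorem singular_d (R : Type) [Ring R] (X : TopCat.{u}) (n : ℕ) :
    ((singular R).obj X).d (n + 1) n = AddCommGrpCat.ofHom (singBoundary R n X) := by
  simp only [singular, singComplex, ChainComplex.of_d]

/-- The natural chain homotopy between natural chain maps `c ↦ c ⊙ φ n` and `c ↦ c ⊙ ψ n` that agree
in degree zero. -/
def naturalHomotopyOfModels {f g : singular.{u} R ⟶ singular R} (hφ : IsModelChainMap φ)
    (hψ : IsModelChainMap ψ) (h_zero : φ 0 = ψ 0)
    (hf : ∀ (X : TopCat.{u}) (n : ℕ),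
      (f.app X).f n = AddCommGrpCat.ofHom (formalComp.flip (φ n)).toAddMonoidHom)
    (hg : ∀ (X : TopCat.{u}) (n : ℕ),
      (g.app X).f n = AddCommGrpCat.ofHom (formalComp.flip (ψ n)).toAddMonoidHom) :
    NaturalHomotopy f g where
  homotopy X := homotopyOfComponents
    (fun n => AddCommGrpCat.ofHom (formalComp.flip (modelHomotopy φ ψ n)).toAddMonoidHom)
    (by
      rw [singular_d, hf, hg, h_zero]
      refine AddCommGrpCat.hom_ext (AddMonoidHom.ext fun (c : SingChain R 0 X) => ?_)
      change c ⊙ ψ 0 = singBoundary R 0 X (c ⊙ modelHomotopy φ ψ 0) + c ⊙ ψ 0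
      rw [modelHomotopy, map_zero, map_zero]
      exact (zero_add _).symm)
    (fun n => by
      rw [singular_d, singular_d, hf, hg]
      exact AddCommGrpCat.hom_ext (AddMonoidHom.ext
        (singBoundary_formalComp_modelHomotopy hφ hψ h_zero)))
  naturality {X Y} k i j := by
    by_cases hij : i + 1 = j
    · subst hij
      simp only [homotopyOfComponents, ↓reduceDIte, eqToHom_refl]
      refine AddCommGrpCat.hom_ext (AddMonoidHom.ext fun (c : SingChain R i X) => ?_)
      change singMap R (i + 1) k.hom (c ⊙ modelHomotopy φ ψ i) =
        singMap R i k.hom c ⊙ modelHomotopy φ ψ i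
      rw [singMap_eq_formalComp, singMap_eq_formalComp, formalComp_assoc]
    · rw [Homotopy.zero _ _ _ hij, Homotopy.zero _ _ _ hij, Limits.zero_comp, Limits.comp_zero]

theorem isModelChainMap_id (R : Type) [CommRing R] :
    IsModelChainMap fun n => Finsupp.single (ContinuousMap.id (Simplex n)) (1 : R) := fun n => by
  rw [singBoundary_id, formalComp_id]

theorem isModelChainMap_triangulate_collapse :
    IsModelChainMap fun n => Finsupp.single (collapse n) 1 ⊙ cubeTriangulation n := fun n => by
  have h := congrArg (triangulate n _) (cubicalBoundary_collapseHom n _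
    (Finsupp.single (ContinuousMap.id (Simplex (n + 1))) 1))
  rwa [← singBoundary_triangulate, triangulate_collapseHom, triangulate_collapseHom, id_formalComp,
    singBoundary_id] at h

theorem collapse_formalComp_cubeTriangulation_zero :
    Finsupp.single (collapse 0) 1 ⊙ cubeTriangulation 0 =
      Finsupp.single (ContinuousMap.id (Simplex 0)) 1 := by
  rw [cubeTriangulation, single_formalComp_single, mul_one]
  exact congrArg (Finsupp.single · 1) (ContinuousMap.ext fun _ => Subsingleton.elim _ _)

/-- The natural chain homotopy between the identity of the singular chain complex and the
composition of the canonical map to cubical chains with the triangulation of cubical chains. -/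
def singToCubicalToSingHomotopy :
    NaturalHomotopy (singToCubical.{u} ≫ cubicalToSing) (𝟙 (singular ℝ)) :=
  naturalHomotopyOfModels isModelChainMap_triangulate_collapse (isModelChainMap_id ℝ)
    collapse_formalComp_cubeTriangulation_zero
    (fun _ _ => AddCommGrpCat.hom_ext (AddMonoidHom.ext triangulate_collapseHom))
    (fun _ _ => AddCommGrpCat.hom_ext (AddMonoidHom.ext fun c => (formalComp_id c).symm))

end Models

/-! ### The `ℓ¹`-norm -/

/-- The `ℓ¹`-norm of a formal linear combination; `singNorm` and `cubicalNorm` are defined by it. -/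
def l1Norm {α E : Type*} [NormedAddCommGroup E] (c : α →₀ E) : ℝ≥0∞ := c.sum fun _ a => ‖a‖ₑ

section L1Norm

variable {α β E : Type*} [NormedAddCommGroup E]

theorem l1Norm_zero : l1Norm (0 : α →₀ E) = 0 := Finsupp.sum_zero_index

theorem l1Norm_single (x : α) (a : E) : l1Norm (Finsupp.single x a) = ‖a‖ₑ :=
  Finsupp.sum_single_index (enorm_zero (E := E))

theorem l1Norm_add_le (c d : α →₀ E) : l1Norm (c + d) ≤ l1Norm c + l1Norm d := by
  classical
  have sum_over_union (e : α →₀ E) (he : e.support ⊆ c.support ∪ d.support) :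
      l1Norm e = ∑ x ∈ c.support ∪ d.support, ‖e x‖ₑ :=
    Finsupp.sum_of_support_subset _ he _ fun _ _ => enorm_zero (E := E)
  rw [sum_over_union _ Finsupp.support_add, sum_over_union c Finset.subset_union_left,
    sum_over_union d Finset.subset_union_right, ← Finset.sum_add_distrib]
  exact Finset.sum_le_sum fun x _ => enorm_add_le _ _

theorem l1Norm_neg (c : α →₀ E) : l1Norm (-c) = l1Norm c := by
  simp [l1Norm, Finsupp.sum]

theorem l1Norm_sub_le (c d : α →₀ E) : l1Norm (c - d) ≤ l1Norm c + l1Norm d := by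
  rw [sub_eq_add_neg, ← l1Norm_neg d]
  exact l1Norm_add_le _ _

theorem l1Norm_sum_le {ι : Type*} (s : Finset ι) (f : ι → α →₀ E) :
    l1Norm (∑ i ∈ s, f i) ≤ ∑ i ∈ s, l1Norm (f i) := by
  refine Finset.le_sum_of_subadditive (l1Norm (α := α) (E := E)) ?_ l1Norm_add_le s f
  exact l1Norm_zero.le

theorem l1Norm_mapDomain_le (f : α → β) (c : α →₀ E) :
    l1Norm (Finsupp.mapDomain f c) ≤ l1Norm c := by
  refine (l1Norm_sum_le _ _).trans (Finset.sum_le_sum fun x _ => ?_)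
  rw [l1Norm_single]

theorem l1Norm_smul_le {R : Type*} [NormedRing R] [Module R E] [IsBoundedSMul R E] (a : R)
    (c : α →₀ E) : l1Norm (a • c) ≤ ‖a‖ₑ * l1Norm c := by
  rw [l1Norm, Finsupp.sum_smul_index' fun _ => enorm_zero (E := E), l1Norm, Finsupp.sum,
    Finsupp.sum, Finset.mul_sum]
  exact Finset.sum_le_sum fun x _ => enorm_smul_le

theorem l1Norm_formalComp_le {R : Type*} [NormedCommRing R] {X Y Z : Type*}
    [TopologicalSpace X] [TopologicalSpace Y] [TopologicalSpace Z] (p : C(Y, Z) →₀ R)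
    (q : C(X, Y) →₀ R) : l1Norm (p ⊙ q) ≤ l1Norm p * l1Norm q := by
  rw [formalComp, Finsupp.linearCombination_apply, LinearMap.finsupp_sum_apply, l1Norm.eq_def p,
    Finsupp.sum_mul]
  refine (l1Norm_sum_le (E := R) _ _).trans (Finset.sum_le_sum fun g _ => ?_)
  exact (l1Norm_smul_le _ _).trans (mul_le_mul_right (l1Norm_mapDomain_le _ _) _)

theorem l1Norm_cubeFaces_le (n : ℕ) : l1Norm (cubeFaces n) ≤ (n + 1) * 2 := by
  have l1Norm_opposite_faces (j : Fin (n + 1)) :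
      l1Norm (Finsupp.single (cubeFace j 1) ((-1 : ℝ) ^ (j : ℕ)) -
        Finsupp.single (cubeFace j 0) ((-1) ^ (j : ℕ))) ≤ 2 := by
    refine (l1Norm_sub_le _ _).trans_eq ?_
    rw [l1Norm_single, l1Norm_single, enorm_pow, enorm_neg, enorm_one, one_pow,
      one_add_one_eq_two]
  refine (l1Norm_sum_le _ _).trans
    ((Finset.sum_le_card_nsmul _ _ 2 fun j _ => l1Norm_opposite_faces j).trans_eq ?_)
  simp

theorem l1Norm_cone_le {R : Type} [NormedCommRing R] {X : Type v} [TopologicalSpace X] {b : X}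
    (H : (ContinuousMap.id X).Homotopy (ContinuousMap.const X b)) {n : ℕ} (c : SingChain R n X) :
    l1Norm (cone H c) ≤ l1Norm c :=
  l1Norm_mapDomain_le _ _

theorem l1Norm_cubeTriangulation_le (n : ℕ) :
    l1Norm (cubeTriangulation n) ≤ 2 ^ n * (n.factorial : ℝ≥0∞) := by
  induction n with
  | zero => simp [cubeTriangulation, l1Norm_single]
  | succ n ih =>
    calc l1Norm (cubeTriangulation (n + 1))
      _ ≤ l1Norm (cubeFaces n ⊙ cubeTriangulation n) := l1Norm_cone_le _ _
      _ ≤ l1Norm (cubeFaces n) * l1Norm (cubeTriangulation n) := l1Norm_formalComp_le _ _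
      _ ≤ ((n + 1) * 2) * (2 ^ n * n.factorial) := mul_le_mul' (l1Norm_cubeFaces_le n) ih
      _ = 2 ^ (n + 1) * (n + 1).factorial := by
        rw [Nat.factorial_succ, pow_succ]
        push_cast
        ring

end L1Norm

/-! ### Semi-norms and bounded chain maps -/

section BoundedMaps

variable {K : ℝ≥0∞}

theorem homologyNorm_map_le {C D : ChainComplex AddCommGrpCat.{u} ℕ} (f : C ⟶ D) {n : ℕ}
    {N : C.X n → ℝ≥0∞} {N' : D.X n → ℝ≥0∞} (hK_zero : K ≠ 0) (hK_top : K ≠ ⊤)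
    (hf : ∀ x, N' ((f.f n).hom x) ≤ K * N x) (α : C.homology n) :
    homologyNorm D n N' ((HomologicalComplex.homologyMap f n).hom α) ≤
      K * homologyNorm C n N α := by
  simp only [homologyNorm, ENNReal.mul_iInf_of_ne hK_zero hK_top]
  refine le_iInf₂ fun z hz => ?_
  have map_class : (D.homologyπ n).hom ((HomologicalComplex.cyclesMap f n).hom z) =
      (HomologicalComplex.homologyMap f n).hom α := by
    rw [← hz]
    exact ConcreteCategory.congr_hom (HomologicalComplex.homologyπ_naturality f n).symm z
  have map_cycle : (D.iCycles n).hom ((HomologicalComplex.cyclesMap f n).hom z) =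
      (f.f n).hom ((C.iCycles n).hom z) :=
    ConcreteCategory.congr_hom (HomologicalComplex.cyclesMap_i f n) z
  refine (iInf₂_le ((HomologicalComplex.cyclesMap f n).hom z) map_class).trans ?_
  rw [map_cycle]
  exact hf _

theorem homologyNorm_comparison {C D : ChainComplex AddCommGrpCat.{u} ℕ} {f : C ⟶ D} {g : D ⟶ C}
    {n : ℕ} {N : C.X n → ℝ≥0∞} {N' : D.X n → ℝ≥0∞} (hK_zero : K ≠ 0) (hK_top : K ≠ ⊤)
    (hfg : HomologicalComplex.homologyMap f n ≫ HomologicalComplex.homologyMap g n = 𝟙 _)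
    (hf : ∀ x, N' ((f.f n).hom x) ≤ 1 * N x) (hg : ∀ y, N ((g.f n).hom y) ≤ K * N' y)
    (α : C.homology n) :
    1 / K * homologyNorm C n N α ≤
        homologyNorm D n N' ((HomologicalComplex.homologyMap f n).hom α) ∧
      homologyNorm D n N' ((HomologicalComplex.homologyMap f n).hom α) ≤
        homologyNorm C n N α := by
  constructor
  · rw [one_div, ENNReal.inv_mul_le_iff hK_zero hK_top]
    have h := homologyNorm_map_le g hK_zero hK_top hg
      ((HomologicalComplex.homologyMap f n).hom α)
    rwa [show (HomologicalComplex.homologyMap g n).hom ((HomologicalComplex.homologyMap f n).hom α)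
      = α from ConcreteCategory.congr_hom hfg α] at h
  · exact (homologyNorm_map_le f one_ne_zero ENNReal.one_ne_top hf α).trans_eq (one_mul _)

variable {F G : TopCat.{u} ⥤ ChainComplex AddCommGrpCat.{u} ℕ}
  {N : ∀ (X : TopCat.{u}) (n : ℕ), (F.obj X).X n → ℝ≥0∞}
  {N' : ∀ (X : TopCat.{u}) (n : ℕ), (G.obj X).X n → ℝ≥0∞} {n : ℕ}

theorem relNorm_relTrans_le {f : F ⟶ G} (hK_zero : K ≠ 0) (hK_top : K ≠ ⊤)
    (hf : ∀ (X : TopCat.{u}) (c : (F.obj X).X n), N' X n (((f.app X).f n).hom c) ≤ K * N X n c)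
    {X : Type u} [TopologicalSpace X] (A : Set X) (c : (relComplex F A).X n) :
    relNorm N' A n (((relTrans f A).f n).hom c) ≤ K * relNorm N A n c := by
  simp only [relNorm, ENNReal.mul_iInf_of_ne hK_zero hK_top]
  refine le_iInf₂ fun b hb => (iInf₂_le (((f.app (TopCat.of X)).f n).hom b) ?_).trans (hf _ b)
  rw [← hb]
  rfl

theorem exists_tendsto_of_forall_le_add {ι : Type*} [Preorder ι] (f : ι → ℝ≥0∞)
    (hf : ∀ ε : ℝ≥0∞, 0 < ε → ∃ i₀, ∀ i j, i₀ ≤ i → i₀ ≤ j → f i ≤ f j + ε) :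
    ∃ l, Tendsto f atTop (𝓝 l) := by
  refine ⟨_, tendsto_of_le_liminf_of_limsup_le le_rfl (?_ : limsup f atTop ≤ liminf f atTop)⟩
  refine ENNReal.le_of_forall_pos_le_add fun ε hε _ => ?_
  obtain ⟨i₀, h⟩ := hf ε (ENNReal.coe_pos.2 hε)
  rw [← tsub_le_iff_right]
  refine le_liminf_of_le (by isBoundedDefault) ?_
  filter_upwards [eventually_ge_atTop i₀] with j hj
  rw [tsub_le_iff_right]
  refine limsup_le_of_le (by isBoundedDefault) ?_
  filter_upwards [eventually_ge_atTop i₀] with i hi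
  exact h i j hi hj

theorem lfNorm_lfTrans_le {f : F ⟶ G} (hK_zero : K ≠ 0) (hK_top : K ≠ ⊤)
    (hf : ∀ (X : TopCat.{u}) (c : (F.obj X).X n), N' X n (((f.app X).f n).hom c) ≤ K * N X n c)
    (hN' : ∀ (X : TopCat.{u}) (x y : (G.obj X).X n), N' X n x ≤ N' X n y + N' X n (x - y))
    (X : Type u) [TopologicalSpace X] (c : (lfComplex F X).X n) :
    lfNorm N' X n (((lfTrans f X).f n).hom c) ≤ K * lfNorm N X n c := by
  simp only [lfNorm, ENNReal.mul_iInf_of_ne hK_zero hK_top]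
  refine le_iInf₂ fun b hb => le_iInf₂ fun b_cauchy l => le_iInf fun hl => ?_
  let b' (L : TopologicalSpace.Compacts X) : (G.obj (TopCat.of X)).X n :=
    ((f.app (TopCat.of X)).f n).hom (b L)
  have hb' (L : TopologicalSpace.Compacts X) :
      relMk G (L : Set X)ᶜ (b' L) = lfComponent G (((lfTrans f X).f n).hom c) L :=
    congrArg ((relTrans f (L : Set X)ᶜ).f n).hom (hb L)
  have b'_cauchy (ε : ℝ≥0∞) (hε : 0 < ε) :
      ∃ L₀, ∀ L L', L₀ ≤ L → L₀ ≤ L' → N' (TopCat.of X) n (b' L - b' L') < ε := by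
    obtain ⟨L₀, h⟩ := b_cauchy (ε / K) (ENNReal.div_pos hε.ne' hK_top)
    refine ⟨L₀, fun L L' hL hL' => ?_⟩
    rw [← map_sub]
    exact (hf _ _).trans_lt (ENNReal.mul_lt_of_lt_div' (h L L' hL hL'))
  obtain ⟨l', hl'⟩ : ∃ l', Tendsto (fun L => N' (TopCat.of X) n (b' L)) atTop (𝓝 l') := by
    refine exists_tendsto_of_forall_le_add _ fun ε hε => ?_
    obtain ⟨L₀, h⟩ := b'_cauchy ε hε
    exact ⟨L₀, fun L L' hL hL' => (hN' _ _ _).trans (add_le_add_right (h L L' hL hL').le _)⟩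
  have limit_le : l' ≤ K * l :=
    le_of_tendsto_of_tendsto' hl' (ENNReal.Tendsto.const_mul hl (Or.inr hK_top)) fun L => hf _ _
  exact (iInf₂_le b' hb').trans ((iInf₂_le b'_cauchy l').trans ((iInf_le _ hl').trans limit_le))

end BoundedMaps

/-! ### Comparison of the singular and the cubical semi-norm -/

theorem singNorm_le_add_sub (X : TopCat.{u}) (n : ℕ) (x y : ((singular ℝ).obj X).X n) :
    singNorm X n x ≤ singNorm X n y + singNorm X n (x - y) :=
  (congrArg (singNorm X n) (add_sub_cancel y x)).symm.trans_le
    (l1Norm_add_le (α := C(Simplex n, X)) (E := ℝ) y (x - y))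

theorem cubicalNorm_le_add_sub (X : TopCat.{u}) (n : ℕ) (x y : (cubical.obj X).X n) :
    cubicalNorm X n x ≤ cubicalNorm X n y + cubicalNorm X n (x - y) := by
  simp only [cubicalNorm, ENNReal.iInf_add, ENNReal.add_iInf]
  refine le_iInf₂ fun q hq => le_iInf₂ fun r hr => ?_
  refine (iInf₂_le (r + q) ?_).trans (l1Norm_add_le r q)
  rw [QuotientAddGroup.mk_add, hq, hr]
  exact add_sub_cancel y x

theorem cubicalNorm_singToCubical_le (X : TopCat.{u}) (n : ℕ) (c : ((singular ℝ).obj X).X n) :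
    cubicalNorm X n (((singToCubical.app X).f n).hom c) ≤ 1 * singNorm X n c := by
  rw [one_mul]
  exact iInf₂_le_of_le (Finsupp.mapDomain (fun σ : C(Simplex n, X) => σ.comp (collapse n))
    (show SingChain ℝ n X from c)) rfl (l1Norm_mapDomain_le _ _)

theorem two_pow_mul_factorial_ne_zero (n : ℕ) : (2 ^ n * (n.factorial : ℝ≥0∞)) ≠ 0 :=
  mul_ne_zero (pow_ne_zero _ two_ne_zero) (Nat.cast_ne_zero.2 n.factorial_ne_zero)

theorem two_pow_mul_factorial_ne_top (n : ℕ) : (2 ^ n * (n.factorial : ℝ≥0∞)) ≠ ⊤ :=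
  ENNReal.mul_ne_top (ENNReal.pow_ne_top ENNReal.ofNat_ne_top) (ENNReal.natCast_ne_top _)

theorem singNorm_cubicalToSing_le (X : TopCat.{u}) (n : ℕ) (c : (cubical.obj X).X n) :
    singNorm X n (((cubicalToSing.app X).f n).hom c) ≤
      2 ^ n * (n.factorial : ℝ≥0∞) * cubicalNorm X n c := by
  simp only [cubicalNorm, ENNReal.mul_iInf_of_ne (two_pow_mul_factorial_ne_zero n)
    (two_pow_mul_factorial_ne_top n)]
  refine le_iInf₂ fun q hq => ?_
  calc singNorm X n (((cubicalToSing.app X).f n).hom c)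
    _ = l1Norm (q ⊙ cubeTriangulation n) := by rw [← hq]; rfl
    _ ≤ l1Norm q * l1Norm (cubeTriangulation n) := l1Norm_formalComp_le _ _
    _ ≤ l1Norm q * (2 ^ n * n.factorial) := by gcongr; exact l1Norm_cubeTriangulation_le n
    _ = 2 ^ n * n.factorial * l1Norm q := mul_comm _ _

theorem one_div_mul_iInf₂_le_and_iInf₂_le {ι : Type*} {p : ι → Prop} {a b : ι → ℝ≥0∞} {K : ℝ≥0∞}
    (h : ∀ i, 1 / K * a i ≤ b i ∧ b i ≤ a i) :
    1 / K * ⨅ (i) (_ : p i), a i ≤ ⨅ (i) (_ : p i), b i ∧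
      ⨅ (i) (_ : p i), b i ≤ ⨅ (i) (_ : p i), a i := by
  refine ⟨?_, iInf₂_mono fun i _ => (h i).2⟩
  exact le_iInf₂ fun i hi => (mul_le_mul_right (iInf₂_le i hi) _).trans (h i).1

end CubicalVolume

end

open CubicalVolume HomologicalComplex in
theorem corollary4p4_general (n : ℕ) (X : Type u) [TopologicalSpace X] :
    (∀ (A : Set X) (α : relHomology ℝ A n),
      1 / (2 ^ n * (n.factorial : ℝ≥0∞)) * homologyNorm _ n (relNorm singNorm A n) α ≤
          homologyNorm _ n (relNorm cubicalNorm A n)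
            ((homologyMap (relTrans singToCubical A) n).hom α) ∧
        homologyNorm _ n (relNorm cubicalNorm A n)
            ((homologyMap (relTrans singToCubical A) n).hom α) ≤
          homologyNorm _ n (relNorm singNorm A n) α) ∧
    (∀ α : (lfComplex (singular.{u} ℝ) X).homology n,
      1 / (2 ^ n * (n.factorial : ℝ≥0∞)) * homologyNorm _ n (lfNorm singNorm X n) α ≤
          homologyNorm _ n (lfNorm cubicalNorm X n)
            ((homologyMap (lfTrans singToCubical X) n).hom α) ∧
        homologyNorm _ n (lfNorm cubicalNorm X n)
            ((homologyMap (lfTrans singToCubical X) n).hom α) ≤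
          homologyNorm _ n (lfNorm singNorm X n) α) := by
  have hK_zero := two_pow_mul_factorial_ne_zero n
  have hK_top := two_pow_mul_factorial_ne_top n
  have homotopy := singToCubicalToSingHomotopy.{u}
  constructor
  · exact fun A => homologyNorm_comparison hK_zero hK_top
      (homotopy.homologyMap_relTrans_comp A n)
      (relNorm_relTrans_le one_ne_zero ENNReal.one_ne_top (cubicalNorm_singToCubical_le · n) A)
      (relNorm_relTrans_le hK_zero hK_top (singNorm_cubicalToSing_le · n) A)
  · exact homologyNorm_comparison hK_zero hK_top
      (homotopy.homologyMap_lfTrans_comp X n)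
      (lfNorm_lfTrans_le one_ne_zero ENNReal.one_ne_top (cubicalNorm_singToCubical_le · n)
        (cubicalNorm_le_add_sub · n) X)
      (lfNorm_lfTrans_le hK_zero hK_top (singNorm_cubicalToSing_le · n)
        (singNorm_le_add_sub · n) X)

theorem corollary4p4 (n : ℕ) :
    (∀ (M : Type u) [TopologicalSpace M] [CompactSpace M],
      CubicalVolume.IsManifoldWithBoundary n M →
      ∀ o : CubicalVolume.ManifoldOrientation n M,
        1 / (2 ^ n * (n.factorial : ℝ≥0∞)) * CubicalVolume.simplicialVolume o ≤
            CubicalVolume.cubicalSimplicialVolume o ∧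
          CubicalVolume.cubicalSimplicialVolume o ≤ CubicalVolume.simplicialVolume o) ∧
    (∀ (M : Type u) [TopologicalSpace M],
      CubicalVolume.IsManifoldWithBoundary n M → CubicalVolume.manifoldBoundary n M = ∅ →
      ∀ o : CubicalVolume.ManifoldOrientation n M,
        1 / (2 ^ n * (n.factorial : ℝ≥0∞)) * CubicalVolume.lfSimplicialVolume o ≤
            CubicalVolume.lfCubicalSimplicialVolume o ∧
          CubicalVolume.lfCubicalSimplicialVolume o ≤ CubicalVolume.lfSimplicialVolume o) :=
  ⟨fun M _ _ _ _ =>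
      CubicalVolume.one_div_mul_iInf₂_le_and_iInf₂_le ((corollary4p4_general n M).1 _),
    fun M _ _ _ _ =>
      CubicalVolume.one_div_mul_iInf₂_le_and_iInf₂_le (corollary4p4_general n M).2⟩
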